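/- Let $k$ be a field of characteristic zero and let $\mathcal G$ be a groupoid with finitely many objects. Let $H=k\mathcal G$ be its groupoid algebra: the $k$-vector space with basis the morphisms of $\mathcal G$, the product $gh$ of two morphisms being the composite $g\circ h$ if it is defined and $0$ otherwise, with unit $\sum_X \mathrm{id}_X$. Let $R=k\mathcal S\subseteq H$, where $\mathcal S\subseteq\mathcal G$ is the subgroupoid with the same objects and only the identity morphisms. Then $H$ is a para-Hopf algebroid over $R$, with source and target maps $\alpha=\beta\colon R\hookrightarrow H$ the inclusion, and, for every morphism $g$, $$\Delta(g)=g\otimes_R g,\qquad \epsilon(g)=\mathrm{id}_{\mathrm{target}(g)},\qquad T(g)=g^{-1}.$$ Let $H_\natural$ be its cocyclic module: $H_\natural^0=R$ and $H_\natural^n=H\otimes_R\cdots\otimes_R H$ ($n$ factors; both $R$-actions on $H$ are by left multiplication), with cofaces $\delta_0(h_1\otimes\cdots\otimes h_n)=1\otimes h_1\otimes\cdots\otimes h_n$, $\ \delta_i(h_1\otimes\cdots\otimes h_n)=h_1\otimes\cdots\otimes\Delta(h_i)\otimes\cdots\otimes h_n$ for $1\le i\le n$, $\ \delta_{n+1}(h_1\otimes\cdots\otimes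 h_n)=h_1\otimes\cdots\otimes h_n\otimes 1$ (in degree $0$, $\delta_0=\delta_1$ is the inclusion $R\hookrightarrow H$), and with the cyclic operator $$\tau_n(h_1\otimes\cdots\otimes h_n)=\Delta^{n-1}T(h_1)\cdot(h_2\otimes\cdots\otimes h_n\otimes 1),\qquad \tau_0=\mathrm{id}.$$ Let $HC^n(H)$ be its cyclic cohomology, that is, the $n$-th cohomology of the total complex of the cyclic bicomplex $C^{p,q}=H_\natural^q$ $(p,q\ge 0)$ with vertical differentials $b=\sum_{i=0}^{q+1}(-1)^i\delta_i$ for $p$ even and $-b'=-\sum_{i=0}^{q}(-1)^i\delta_i$ for $p$ odd, and horizontal differentials $1-\lambda$ for $p$ even and $1+\lambda+\cdots+\lambda^q$ for $p$ odd, where $\lambda=(-1)^q\tau_q$. Then the total differential squares to zero, and for all $i\ge 0$ $$HC^{2i+1}(H)=0\qquad\text{and}\qquad HC^{2i}(H)\cong R\quad\text{as $k$-vector spaces.}$$ -/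

import Mathlib

open scoped TensorProduct

universe w h

/-- A left module over the `k`-algebra `R` (with compatible `k`-structure). -/
structure LMod (k : Type w) (R : Type h) [CommRing k] [Ring R] [Algebra k R] where
  carrier : Type h
  [grp : AddCommGroup carrier]
  [mod : Module k carrier]
  /-- the left action of `R` -/
  act : R →ₐ[k] Module.End k carrier

namespace LMod

variable {k : Type w} {R : Type h} [CommRing k] [Ring R] [Algebra k R]

instance : CoeSort (LMod k R) (Type h) := ⟨LMod.carrier⟩

attribute [instance] LMod.grp LMod.mod

/-- Left `R`-linear maps. -/
structure Hom (M N : LMod k R) where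
  map : M →ₗ[k] N
  map_act : ∀ (r : R) (m : M), map (M.act r m) = N.act r (map m)

end LMod

/-- The underlying data of a bialgebroid: total algebra `H`, base algebra `R`, source map `α`, target map
`β` (an anti-homomorphism, that is a homomorphism to the opposite algebra), with commuting images. -/
structure BaseData (k : Type w) (R H : Type h) [CommRing k] [Ring R] [Algebra k R]
    [Ring H] [Algebra k H] where
  α : R →ₐ[k] H
  β : R →ₐ[k] Hᵐᵒᵖ
  comm : ∀ a b : R, α a * (β b).unop = (β b).unop * α a

namespace BaseData

variable {k : Type w} {R H : Type h} [CommRing k] [Ring R] [Algebra k R] [Ring H] [Algebra k H]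
variable (B : BaseData k R H)

/-- The target map, with values in `H`. -/
def tgt (r : R) : H := (B.β r).unop

/-- `H` as a left `R`-module, `r · x = α(r) x`. -/
abbrev self : LMod k R where
  carrier := H
  act := (Algebra.lmul k H).comp B.α

/-- The relations `(x · r) ⊗ m = x ⊗ (r · m)`, where `x · r = β(r) x`. -/
def rel (M : LMod k R) : Submodule k (H ⊗[k] M) :=
  Submodule.span k {z | ∃ (r : R) (x : H) (m : M), z = (B.tgt r * x) ⊗ₜ[k] m - x ⊗ₜ[k] M.act r m}

/-- The tensor product `H ⊗_R M` for the right `R`-module structure `x · r = β(r) x` of `H`. -/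
abbrev Tens (M : LMod k R) : Type h := (H ⊗[k] M) ⧸ B.rel M

/-- The projection `H ⊗ M → H ⊗_R M`. -/
def proj (M : LMod k R) : H ⊗[k] M →ₗ[k] B.Tens M := (B.rel M).mkQ

/-- The pure tensor `x ⊗_R m`. -/
def tmul (M : LMod k R) : H →ₗ[k] M →ₗ[k] B.Tens M :=
  (TensorProduct.mk k H M).compr₂ (B.proj M)

theorem tmul_tgt (M : LMod k R) (r : R) (x : H) (m : M) :
    B.tmul M (B.tgt r * x) m = B.tmul M x (M.act r m) :=
  (Submodule.Quotient.eq _).2 (Submodule.subset_span ⟨r, x, m, rfl⟩)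

/-- Balanced bilinear maps factor through `H ⊗_R M`. -/
def lift {M : LMod k R} {N : Type h} [AddCommGroup N] [Module k N] (f : H →ₗ[k] M →ₗ[k] N)
    (hf : ∀ r x m, f (B.tgt r * x) m = f x (M.act r m)) : B.Tens M →ₗ[k] N :=
  (B.rel M).liftQ (TensorProduct.lift f) (by
    refine Submodule.span_le.2 ?_
    rintro _ ⟨r, x, m, rfl⟩
    simp [hf])

theorem lift_tmul {M : LMod k R} {N : Type h} [AddCommGroup N] [Module k N]
    (f : H →ₗ[k] M →ₗ[k] N) (hf : ∀ r x m, f (B.tgt r * x) m = f x (M.act r m)) (x : H) (m : M) :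
    B.lift f hf (B.tmul M x m) = f x m := rfl

theorem hom_ext {M : LMod k R} {N : Type*} [AddCommGroup N] [Module k N] {f g : B.Tens M →ₗ[k] N}
    (hfg : ∀ x m, f (B.tmul M x m) = g (B.tmul M x m)) : f = g := by
  refine Submodule.linearMap_qext _ (TensorProduct.ext' fun x m => ?_)
  exact hfg x m

theorem commute (a b : R) (x : H) : B.α a * (B.tgt b * x) = B.tgt b * (B.α a * x) := by
  rw [← mul_assoc, ← mul_assoc]
  exact congrArg (· * x) (B.comm a b)

/-- The left action of `R` on `H ⊗_R M`: `r · (x ⊗ m) = α(r) x ⊗ m`. -/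
def lact (M : LMod k R) (r : R) : B.Tens M →ₗ[k] B.Tens M :=
  B.lift ((B.tmul M).comp (LinearMap.mulLeft k (B.α r))) (fun s x m => by
    simp only [LinearMap.comp_apply, LinearMap.mulLeft_apply, B.commute]
    exact B.tmul_tgt M s _ m)

theorem lact_tmul (M : LMod k R) (r : R) (x : H) (m : M) :
    B.lact M r (B.tmul M x m) = B.tmul M (B.α r * x) m := rfl

/-- `H ⊗_R M` as a left `R`-module. -/
abbrev tens (M : LMod k R) : LMod k R where
  carrier := B.Tens M
  act := AlgHom.ofLinearMap
    { toFun := B.lact M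
      map_add' := fun r s => B.hom_ext fun x m => by
        simp only [LinearMap.add_apply, lact_tmul, map_add, add_mul]
      map_smul' := fun c r => B.hom_ext fun x m => by
        simp only [LinearMap.smul_apply, RingHom.id_apply, lact_tmul, map_smul, smul_mul_assoc] }
    (B.hom_ext fun x m => by
      change B.lact M 1 _ = _
      rw [lact_tmul, map_one, one_mul]; rfl)
    (fun r s => by
      change B.lact M (r * s) = (B.lact M r).comp (B.lact M s)
      refine B.hom_ext fun x m => ?_
      rw [LinearMap.comp_apply]
      rw [lact_tmul, lact_tmul, lact_tmul, map_mul B.α, mul_assoc])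

theorem lact_zero (M : LMod k R) : B.lact M 0 = 0 := map_zero (B.tens M).act

theorem lact_add (M : LMod k R) (r s : R) : B.lact M (r + s) = B.lact M r + B.lact M s :=
  map_add (B.tens M).act r s

theorem lact_smul (M : LMod k R) (c : k) (r : R) : B.lact M (c • r) = c • B.lact M r :=
  map_smul (B.tens M).act c r

/-- `H ⊗_R ⋯ ⊗_R H` with `n + 1` factors. -/
def pow : ℕ → LMod k R
  | 0 => B.self
  | n + 1 => B.tens (pow n)

/-- `id ⊗_R f` as a `k`-linear map. -/
def idTensMap {M N : LMod k R} (f : LMod.Hom M N) : B.Tens M →ₗ[k] B.Tens N :=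
  B.lift ((B.tmul N).compl₂ f.map) (fun r x m => by
    rw [LinearMap.compl₂_apply, LinearMap.compl₂_apply, f.map_act]
    exact B.tmul_tgt N r x _)

theorem idTensMap_tmul {M N : LMod k R} (f : LMod.Hom M N) (x : H) (m : M) :
    B.idTensMap f (B.tmul M x m) = B.tmul N x (f.map m) := rfl

/-- `id ⊗_R f`. -/
def idTens {M N : LMod k R} (f : LMod.Hom M N) : LMod.Hom (B.tens M) (B.tens N) where
  map := B.idTensMap f
  map_act r z := by
    have key : (B.idTensMap f).comp (B.lact M r) = (B.lact N r).comp (B.idTensMap f) :=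
      B.hom_ext fun x m => by
        rw [LinearMap.comp_apply, LinearMap.comp_apply, lact_tmul, idTensMap_tmul, idTensMap_tmul,
          lact_tmul]
    exact LinearMap.congr_fun key z

/-- The right action of `R` on `H ⊗_R H`: `(x ⊗ y) · r = x ⊗ β(r) y`. -/
def ractR (r : R) : B.Tens B.self →ₗ[k] B.Tens B.self :=
  B.lift (M := B.self) ((B.tmul B.self).compl₂ (LinearMap.mulLeft k (B.tgt r))) (fun s x y => by
    refine (B.tmul_tgt B.self s x _).trans ?_
    exact congrArg (B.tmul B.self x) (B.commute s r y))

/-- The right action of the algebra `H ⊗ H` on `H ⊗_R H`: `(x ⊗ y) · (a ⊗ b) = x a ⊗ y b`. -/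
def ractH (v : H ⊗[k] H) : B.Tens B.self →ₗ[k] B.Tens B.self :=
  (B.rel B.self).mapQ (B.rel B.self) (LinearMap.mulRight k (A := H ⊗[k] H) v) (by
    refine Submodule.span_le.2 ?_
    rintro _ ⟨r, x, y, rfl⟩
    change ((B.tgt r * x) ⊗ₜ[k] (y : H) - x ⊗ₜ[k] (B.α r * y : H)) * v ∈ B.rel B.self
    induction v with
    | zero => rw [mul_zero]; exact zero_mem _
    | add a b ha hb => rw [mul_add]; exact add_mem ha hb
    | tmul a b =>
      refine Submodule.subset_span ⟨r, x * a, (y * b : H), ?_⟩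
      rw [sub_mul, Algebra.TensorProduct.tmul_mul_tmul, Algebra.TensorProduct.tmul_mul_tmul,
        mul_assoc, mul_assoc]
      rfl)

theorem ractH_tmul (a b x y : H) :
    B.ractH (a ⊗ₜ b) (B.tmul B.self x y) = B.tmul B.self (x * a) (y * b : H) :=
  congrArg (B.proj B.self) (Algebra.TensorProduct.tmul_mul_tmul (R := k) x a (y : H) b)

theorem ractH_proj (v z : H ⊗[k] H) :
    B.ractH v (B.proj B.self z) = B.proj B.self (z * v) := rfl

theorem ractH_add (v w : H ⊗[k] H) : B.ractH (v + w) = B.ractH v + B.ractH w := by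
  refine Submodule.linearMap_qext _ (LinearMap.ext fun z => ?_)
  exact congrArg (B.proj B.self) (mul_add (z : H ⊗[k] H) v w)

theorem ractH_sub (v w : H ⊗[k] H) : B.ractH (v - w) = B.ractH v - B.ractH w := by
  refine Submodule.linearMap_qext _ (LinearMap.ext fun z => ?_)
  exact congrArg (B.proj B.self) (mul_sub (z : H ⊗[k] H) v w)

theorem ractH_smul (c : k) (v : H ⊗[k] H) : B.ractH (c • v) = c • B.ractH v := by
  refine Submodule.linearMap_qext _ (LinearMap.ext fun z => ?_)
  exact congrArg (B.proj B.self) (mul_smul_comm c (z : H ⊗[k] H) v)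

theorem ractH_mul (v w : H ⊗[k] H) (z : B.Tens B.self) :
    B.ractH (v * w) z = B.ractH w (B.ractH v z) := by
  obtain ⟨u, rfl⟩ := Submodule.Quotient.mk_surjective _ z
  exact congrArg (B.proj B.self) (mul_assoc (u : H ⊗[k] H) v w).symm

/-- The identification `(H ⊗_R H) ⊗_R M = H ⊗_R (H ⊗_R M)`, as a bilinear map
`(x ⊗ y, m) ↦ x ⊗ (y ⊗ m)`. -/
def assoc (M : LMod k R) : B.Tens B.self →ₗ[k] M →ₗ[k] B.Tens (B.tens M) :=
  B.lift (M := B.self)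
    (LinearMap.mk₂ k (fun x (y : H) => (B.tmul (B.tens M) x).comp (B.tmul M y))
      (fun x x' y => by rw [map_add, LinearMap.add_comp])
      (fun c x y => by rw [map_smul, LinearMap.smul_comp])
      (fun x y y' => by rw [map_add, LinearMap.comp_add])
      (fun c x y => by rw [map_smul, LinearMap.comp_smul]))
    (fun r x y => LinearMap.ext fun m => B.tmul_tgt (B.tens M) r x (B.tmul M (y : H) m))

end BaseData

/-- The underlying data together with an `(R, R)`-bimodule map `Δ : H → H ⊗_R H`. -/
structure CoringData (k : Type w) (R H : Type h) [CommRing k] [Ring R] [Algebra k R]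
    [Ring H] [Algebra k H] extends BaseData k R H where
  Δ : H →ₗ[k] toBaseData.Tens toBaseData.self
  Δ_left : ∀ (a : R) (x : H), Δ (α a * x) = toBaseData.lact toBaseData.self a (Δ x)
  Δ_right : ∀ (b : R) (x : H), Δ (toBaseData.tgt b * x) = toBaseData.ractR b (Δ x)

namespace CoringData

variable {k : Type w} {R H : Type h} [CommRing k] [Ring R] [Algebra k R] [Ring H] [Algebra k H]
variable (C : CoringData k R H)

/-- `Δ` as a map of left `R`-modules. -/
def comul : LMod.Hom C.self (C.tens C.self) where
  map := C.Δ
  map_act := C.Δ_left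

/-- `Δ ⊗_R id : H ⊗_R M → H ⊗_R H ⊗_R M`. -/
def comulTens (M : LMod k R) : LMod.Hom (C.tens M) (C.tens (C.tens M)) where
  map := C.lift ((C.assoc M).comp C.Δ) (fun r x m => by
    have key : ((C.assoc M).flip m).comp (C.ractR r) = (C.assoc M).flip (M.act r m) :=
      C.hom_ext fun x y => congrArg (C.tmul (C.tens M) x) (C.tmul_tgt M r y m)
    simp only [LinearMap.comp_apply, C.Δ_right]
    exact LinearMap.congr_fun key (C.Δ x))
  map_act r z := by
    let f := C.lift ((C.assoc M).comp C.Δ) (fun r x m => by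
      have key : ((C.assoc M).flip m).comp (C.ractR r) = (C.assoc M).flip (M.act r m) :=
        C.hom_ext fun x y => congrArg (C.tmul (C.tens M) x) (C.tmul_tgt M r y m)
      simp only [LinearMap.comp_apply, C.Δ_right]
      exact LinearMap.congr_fun key (C.Δ x))
    have : f.comp (C.lact M r) = (C.lact (C.tens M) r).comp f := C.hom_ext fun x m => by
      have key : ((C.assoc M).flip m).comp (C.lact C.self r)
          = (C.lact (C.tens M) r).comp ((C.assoc M).flip m) := C.hom_ext fun x y => rfl
      change C.assoc M (C.Δ (C.α r * x)) m = C.lact (C.tens M) r (C.assoc M (C.Δ x) m)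
      rw [C.Δ_left]
      exact LinearMap.congr_fun key (C.Δ x)
    exact LinearMap.congr_fun this z

end CoringData

/-- A bialgebroid `(H, R, α, β, Δ, ε)` over `k`. -/
structure Bialgebroid (k : Type w) (R H : Type h) [CommRing k] [Ring R] [Algebra k R]
    [Ring H] [Algebra k H] extends CoringData k R H where
  Δ_one : Δ 1 = toBaseData.tmul toBaseData.self 1 (1 : H)
  /-- `(Δ ⊗ id) Δ = (id ⊗ Δ) Δ` -/
  coassoc : ∀ x : H, (toCoringData.comulTens toBaseData.self).map (Δ x)
    = (toBaseData.idTens toCoringData.comul).map (Δ x)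
  /-- `Δ(a) (β(r) ⊗ 1 - 1 ⊗ α(r)) = 0` -/
  Δ_takeuchi : ∀ (a : H) (r : R),
    toBaseData.ractH (toBaseData.tgt r ⊗ₜ 1 - 1 ⊗ₜ α r) (Δ a) = 0
  /-- `Δ(a b) = Δ(a) Δ(b)`, the right-hand side being computed with any representative of `Δ(b)` -/
  Δ_mul : ∀ (a b : H) (v : H ⊗[k] H), toBaseData.proj toBaseData.self v = Δ b →
    Δ (a * b) = toBaseData.ractH v (Δ a)
  ε : H →ₗ[k] R
  ε_left : ∀ (a : R) (x : H), ε (α a * x) = a * ε x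
  ε_right : ∀ (b : R) (x : H), ε (toBaseData.tgt b * x) = ε x * b
  ε_one : ε 1 = 1
  /-- `(ε ⊗_R id) Δ = id`, where `r ⊗_R y = α(r) y` -/
  counit_left : ∀ (x : H) (v : H ⊗[k] H), toBaseData.proj toBaseData.self v = Δ x →
    TensorProduct.lift ((LinearMap.mul k H).comp (α.toLinearMap.comp ε)) v = x
  /-- `(id ⊗_R ε) Δ = id`, where `x ⊗_R r = β(r) x` -/
  counit_right : ∀ (x : H) (v : H ⊗[k] H), toBaseData.proj toBaseData.self v = Δ x →
    TensorProduct.lift ((LinearMap.mul k H).flip.compl₂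
      ((MulOpposite.opLinearEquiv k).symm.toLinearMap.comp (β.toLinearMap.comp ε))) v = x

/-- A para-Hopf algebroid: a bialgebroid with a para-antipode `T`, an algebra anti-homomorphism
`H → H` (that is, a homomorphism to the opposite algebra). -/
structure ParaHopfAlgebroid (k : Type w) (R H : Type h) [CommRing k] [Ring R] [Algebra k R]
    [Ring H] [Algebra k H] extends Bialgebroid k R H where
  T : H →ₐ[k] Hᵐᵒᵖ
  /-- `T β = α` -/
  T_tgt : ∀ r : R, (T (toBaseData.tgt r)).unop = α r
  /-- `m (T ⊗ id) Δ = β ε T`, i.e. `T(h⁽¹⁾) h⁽²⁾ = β(ε(T(h)))` -/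
  T_mul : ∀ (x : H) (v : H ⊗[k] H), toBaseData.proj toBaseData.self v = Δ x →
    TensorProduct.lift ((LinearMap.mul k H).comp
      ((MulOpposite.opLinearEquiv k).symm.toLinearMap.comp T.toLinearMap)) v
      = toBaseData.tgt (ε (T x).unop)
  T_T : ∀ x : H, (T (T x).unop).unop = x
  /-- `T(h⁽¹⁾)⁽¹⁾ h⁽²⁾ ⊗_R T(h⁽¹⁾)⁽²⁾ = 1 ⊗_R T(h)`, the left-hand side being `∑ Δ(T(x)) · (y ⊗ 1)`
  for `Δ(h) = ∑ x ⊗_R y` -/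
  T_comul : ∀ (h : H) (n : ℕ) (x y : Fin n → H),
    ∑ i, toBaseData.tmul toBaseData.self (x i) (y i) = Δ h →
    ∑ i, toBaseData.ractH (y i ⊗ₜ 1) (Δ (T (x i)).unop)
      = toBaseData.tmul toBaseData.self 1 ((T h).unop : H)

namespace Bialgebroid

variable {k : Type w} {R H : Type h} [CommRing k] [Ring R] [Algebra k R] [Ring H] [Algebra k H]
variable (B : Bialgebroid k R H)

/-- A `k`-linear action of `H` on `M` (as a map `H ⊗ M → M`) compatible with the action of `R`. -/
structure HAct (M : LMod k R) where
  map : H →ₗ[k] M →ₗ[k] M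
  map_left : ∀ (r : R) (x : H) (m : M), map (B.α r * x) m = M.act r (map x m)
  map_right : ∀ (r : R) (x : H) (m : M), map (x * B.α r) m = map x (M.act r m)

/-- The left multiplication action of `H` on itself. -/
def selfAct : B.HAct B.self where
  map := LinearMap.mul k H
  map_left r x y := mul_assoc (B.α r) x (y : H)
  map_right r x y := mul_assoc x (B.α r) (y : H)

variable {B}

/-- `(a ⊗ b, x, m) ↦ a x ⊗ b m`. -/
def HAct.pair {M : LMod k R} (D : B.HAct M) :
    B.Tens B.self →ₗ[k] H →ₗ[k] M →ₗ[k] B.Tens M :=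
  B.lift (M := B.self)
    (LinearMap.mk₂ k
      (fun a (b : H) => ((B.tmul M).compl₂ (D.map b)).comp (LinearMap.mulLeft k a))
      (fun a a' b => by ext x m; simp [add_mul])
      (fun c a b => by ext x m; simp)
      (fun a b b' => by
        ext x m
        simp only [map_add, LinearMap.comp_apply, LinearMap.compl₂_apply, LinearMap.add_apply])
      (fun c a b => by
        ext x m
        simp only [map_smul, LinearMap.comp_apply, LinearMap.compl₂_apply, LinearMap.smul_apply]))
    (fun r a b => by
      refine LinearMap.ext fun x => LinearMap.ext fun m => ?_
      change B.tmul M (B.tgt r * a * x) (D.map (b : H) m)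
        = B.tmul M (a * x) (D.map (B.α r * (b : H)) m)
      rw [D.map_left, mul_assoc]
      exact B.tmul_tgt M r (a * x) _)

theorem HAct.pair_tmul {M : LMod k R} (D : B.HAct M) (a b x : H) (m : M) :
    D.pair (B.tmul B.self a b) x m = B.tmul M (a * x) (D.map b m) := rfl

theorem HAct.pair_balanced {M : LMod k R} (D : B.HAct M) (h x : H) (r : R) (m : M) :
    D.pair (B.Δ h) (B.tgt r * x) m = D.pair (B.Δ h) x (M.act r m) := by
  have e : ∀ z : B.Tens B.self,
      D.pair (B.ractH (B.tgt r ⊗ₜ 1) z) x m = D.pair z (B.tgt r * x) m := by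
    intro z
    obtain ⟨v, rfl⟩ := Submodule.Quotient.mk_surjective _ z
    induction v with
    | zero => simp
    | add v w hv hw =>
      rw [Submodule.Quotient.mk_add]
      simp only [map_add, LinearMap.add_apply, hv, hw]
    | tmul a b =>
      change D.pair (B.ractH (B.tgt r ⊗ₜ 1) (B.tmul B.self a b)) x m
        = D.pair (B.tmul B.self a b) (B.tgt r * x) m
      rw [B.ractH_tmul, HAct.pair_tmul, HAct.pair_tmul, mul_assoc, mul_one]
  have e' : ∀ z : B.Tens B.self,
      D.pair (B.ractH (1 ⊗ₜ B.α r) z) x m = D.pair z x (M.act r m) := by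
    intro z
    obtain ⟨v, rfl⟩ := Submodule.Quotient.mk_surjective _ z
    induction v with
    | zero => simp
    | add v w hv hw =>
      rw [Submodule.Quotient.mk_add]
      simp only [map_add, LinearMap.add_apply, hv, hw]
    | tmul a b =>
      change D.pair (B.ractH (1 ⊗ₜ B.α r) (B.tmul B.self a b)) x m
        = D.pair (B.tmul B.self a b) x (M.act r m)
      rw [B.ractH_tmul, HAct.pair_tmul, HAct.pair_tmul, mul_one, D.map_right]
  have h0 : B.ractH (B.tgt r ⊗ₜ 1) (B.Δ h) = B.ractH (1 ⊗ₜ B.α r) (B.Δ h) := by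
    have := B.Δ_takeuchi h r
    rw [B.ractH_sub] at this
    exact sub_eq_zero.1 this
  rw [← e, ← e', h0]

theorem Δ_mul_src (h : H) (r : R) : B.Δ (h * B.α r) = B.ractH (B.α r ⊗ₜ 1) (B.Δ h) := by
  refine B.Δ_mul h (B.α r) _ ?_
  have := B.Δ_left r 1
  rw [mul_one, B.Δ_one, B.lact_tmul, mul_one] at this
  exact this.symm

/-- The diagonal action on `H ⊗_R M`: `h · (x ⊗ m) = h⁽¹⁾ x ⊗ h⁽²⁾ m`. -/
def HAct.diag {M : LMod k R} (D : B.HAct M) : B.HAct (B.tens M) where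
  map :=
    { toFun := fun h => B.lift (D.pair (B.Δ h)) (fun r x m => D.pair_balanced h x r m)
      map_add' := fun h h' => B.hom_ext fun x m => by
        simp only [LinearMap.add_apply, B.lift_tmul, map_add]
      map_smul' := fun c h => B.hom_ext fun x m => by
        simp only [LinearMap.smul_apply, B.lift_tmul, map_smul, RingHom.id_apply] }
  map_left r h z := by
    have key : B.lift (D.pair (B.Δ (B.α r * h))) (fun s x m => D.pair_balanced _ x s m)
        = (B.lact M r).comp
            (B.lift (D.pair (B.Δ h)) (fun s x m => D.pair_balanced h x s m)) :=
      B.hom_ext fun x m => by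
        rw [LinearMap.comp_apply, B.lift_tmul, B.lift_tmul, B.Δ_left]
        have e : ((D.pair.flip x).flip m).comp (B.lact B.self r)
            = (B.lact M r).comp ((D.pair.flip x).flip m) := B.hom_ext fun a b => by
          change B.tmul M (B.α r * a * x) (D.map (b : H) m)
            = B.tmul M (B.α r * (a * x)) (D.map (b : H) m)
          rw [mul_assoc]
        exact LinearMap.congr_fun e (B.Δ h)
    exact LinearMap.congr_fun key z
  map_right r h z := by
    have key : B.lift (D.pair (B.Δ (h * B.α r))) (fun s x m => D.pair_balanced _ x s m)
        = (B.lift (D.pair (B.Δ h)) (fun s x m => D.pair_balanced h x s m)).comp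
            (B.lact M r) :=
      B.hom_ext fun x m => by
        rw [LinearMap.comp_apply, B.lift_tmul, B.lact_tmul, B.lift_tmul, Δ_mul_src]
        have e : ((D.pair.flip x).flip m).comp (B.ractH (B.α r ⊗ₜ 1))
            = (D.pair.flip (B.α r * x)).flip m := B.hom_ext fun a b => by
          rw [LinearMap.comp_apply, B.ractH_tmul]
          change B.tmul M (a * B.α r * x) (D.map ((b : H) * 1) m)
            = B.tmul M (a * (B.α r * x)) (D.map (b : H) m)
          rw [mul_assoc, mul_one]
        exact LinearMap.congr_fun e (B.Δ h)
    exact LinearMap.congr_fun key z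

variable (B)

/-- The diagonal action `h ▹ (g₁ ⊗ ⋯ ⊗ g_{n+1}) = h⁽¹⁾ g₁ ⊗ ⋯ ⊗ h⁽ⁿ⁺¹⁾ g_{n+1}`. -/
def diagAct : (n : ℕ) → B.HAct (B.pow n)
  | 0 => B.selfAct
  | n + 1 => (diagAct n).diag

/-- `h₁ ⊗ ⋯ ⊗ h_{n+1} ↦ h₁ ⊗ ⋯ ⊗ h_{n+1} ⊗ 1`. -/
def append : (n : ℕ) → LMod.Hom (B.pow n) (B.pow (n + 1))
  | 0 =>
    { map := (B.tmul B.self).flip (1 : H)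
      map_act := fun _ _ => rfl }
  | n + 1 => B.idTens (append n)

/-- `insert n j` applies `Δ` to the factor `h_{j+1}` of `h₁ ⊗ ⋯ ⊗ h_{n+1}` if `j ≤ n`, and appends
`1` at the end otherwise. So this is the coface `δ_{j+1}`. -/
def insert : (n j : ℕ) → LMod.Hom (B.pow n) (B.pow (n + 1))
  | 0, 0 => B.comul
  | 0, _ + 1 => B.append 0
  | n + 1, 0 => B.comulTens (B.pow n)
  | n + 1, j + 1 => B.idTens (insert n j)

end Bialgebroid

/-- The part of a cocyclic module over `k` from which its cyclic cohomology is computed: modules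
`X n`, cofaces `δ n i : X n → X (n + 1)` for `0 ≤ i ≤ n + 1`, cyclic operators `τ n`. -/
structure CocyclicData (k : Type w) [CommRing k] where
  X : ℕ → ModuleCat.{h} k
  δ : (n : ℕ) → Fin (n + 2) → X n →ₗ[k] X (n + 1)
  τ : (n : ℕ) → X n →ₗ[k] X n

namespace CocyclicData

variable {k : Type w} [CommRing k] (X : CocyclicData.{w, h} k)

/-- The Hochschild coboundary `b = ∑_{i=0}^{n+1} (-1)^i δ_i`. -/
def b (n : ℕ) : X.X n →ₗ[k] X.X (n + 1) :=
  ∑ i : Fin (n + 2), (-1 : k) ^ (i : ℕ) • X.δ n i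

/-- `b' = ∑_{i=0}^{n} (-1)^i δ_i`. -/
def b' (n : ℕ) : X.X n →ₗ[k] X.X (n + 1) :=
  ∑ i : Fin (n + 1), (-1 : k) ^ (i : ℕ) • X.δ n i.castSucc

/-- The signed cyclic operator `λ = (-1)^n τ_n`. -/
def lam (n : ℕ) : Module.End k (X.X n) := (-1 : k) ^ n • X.τ n

/-- The norm `N = 1 + λ + ⋯ + λ^n`. -/
def norm (n : ℕ) : Module.End k (X.X n) := ∑ i ∈ Finset.range (n + 1), X.lam n ^ i

/-- The vertical differential `C^{p,q} → C^{p,q+1}` of the cyclic bicomplex `C^{p,q} = X q`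
(`p, q ≥ 0`): `b` in the even columns, `-b'` in the odd ones. -/
def vert (p q : ℕ) : X.X q →ₗ[k] X.X (q + 1) := if Even p then X.b q else -X.b' q

/-- The horizontal differential `C^{p,q} → C^{p+1,q}`: `1 - λ` out of the even columns, `N` out of
the odd ones. -/
def horiz (p q : ℕ) : X.X q →ₗ[k] X.X q := if Even p then 1 - X.lam q else X.norm q

/-- The degree `n` part `⨁_{p+q=n} C^{p,q}` of the total complex, indexed by `q`. -/
abbrev Tot (n : ℕ) : Type h := (q : Fin (n + 1)) → X.X q

/-- The total differential: the component in `C^{n+1-q,q}` is the sum of the vertical differential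
out of `C^{n+1-q,q-1}` (if `q ≥ 1`) and of the horizontal one out of `C^{n-q,q}` (if `q ≤ n`). -/
def d (n : ℕ) : X.Tot n →ₗ[k] X.Tot (n + 1) :=
  LinearMap.pi fun q =>
    (match q with
      | ⟨0, _⟩ => 0
      | ⟨j + 1, hj⟩ => (X.vert (n - j) j).comp (LinearMap.proj (⟨j, by omega⟩ : Fin (n + 1)))) +
    (if hq : (q : ℕ) < n + 1 then
      (X.horiz (n - q) q).comp (LinearMap.proj (⟨q, hq⟩ : Fin (n + 1)))
    else 0)

/-- The coboundaries of degree `n` in the total complex. -/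
def boundaries : (n : ℕ) → Submodule k (X.Tot n)
  | 0 => ⊥
  | n + 1 => LinearMap.range (X.d n)

/-- Cyclic cohomology: the cohomology `ker d / im d` of the total complex of the cyclic
bicomplex (meaningful when `d ∘ d = 0`, as is the case for a cocyclic module). -/
abbrev HC (n : ℕ) : Type h :=
  LinearMap.ker (X.d n) ⧸ (X.boundaries n).comap (LinearMap.ker (X.d n)).subtype

end CocyclicData

namespace ParaHopfAlgebroid

variable {k : Type w} {R H : Type h} [CommRing k] [Ring R] [Algebra k R] [Ring H] [Algebra k H]
variable (P : ParaHopfAlgebroid k R H)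

/-- The para-antipode with values in `H`. -/
def antipode : H →ₗ[k] H := (MulOpposite.opLinearEquiv k).symm.toLinearMap.comp P.T.toLinearMap

theorem antipode_tgt_mul (r : R) (x : H) :
    P.antipode (P.tgt r * x) = P.antipode x * P.α r := by
  have : P.antipode (P.tgt r * x) = (P.T x).unop * (P.T (P.tgt r)).unop := by
    change (P.T (P.tgt r * x)).unop = _
    rw [map_mul, MulOpposite.unop_mul]
  rw [this, P.T_tgt]; rfl

/-- The cyclic operator on `n + 1` factors,
`τ(h₁ ⊗ ⋯ ⊗ h_{n+1}) = Δⁿ(T(h₁)) · (h₂ ⊗ ⋯ ⊗ h_{n+1} ⊗ 1) = T(h₁) ▹ (h₂ ⊗ ⋯ ⊗ h_{n+1} ⊗ 1)`. -/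
def cyc : (n : ℕ) → P.pow n →ₗ[k] P.pow n
  | 0 => P.antipode
  | n + 1 =>
    P.lift (M := P.pow n)
      (((P.diagAct (n + 1)).map.compl₂ (P.append n).map).comp P.antipode)
      (fun r x m => by
        rw [LinearMap.comp_apply, LinearMap.comp_apply, P.antipode_tgt_mul,
          LinearMap.compl₂_apply, LinearMap.compl₂_apply, (P.diagAct (n + 1)).map_right,
          (P.append n).map_act])

/-- The cofaces on `n + 1` factors: `δ₀ = 1 ⊗ -`, and the others apply `Δ` to a factor or
append `1`. -/
def coface (n : ℕ) (i : Fin (n + 3)) : P.pow n →ₗ[k] P.pow (n + 1) :=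
  Fin.cases (P.tmul (P.pow n) 1) (fun j => (P.insert n j).map) i

/-- The cofaces in degree zero, `δ₀ = β` and `δ₁ = α`. For the bimodule structure used here
(`r · x · s = α(r) β(s) x`, so that `1 ⊗_R α(r) = β(r) ⊗_R 1`, `Δ(α(r)) = α(r) ⊗_R 1` and
`Δ(β(r)) = 1 ⊗_R β(r)`) this is the order for which `δ₁ δ₀ = δ₀ δ₀`; if `α = β`, as for groupoid
algebras, there is no difference. -/
def coface₀ (i : Fin 2) : R →ₗ[k] H :=
  Fin.cases ((MulOpposite.opLinearEquiv k).symm.toLinearMap.comp P.β.toLinearMap)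
    (fun _ => P.α.toLinearMap) i

/-- The cocyclic module `H_♮` of a para-Hopf algebroid: `H_♮⁰ = R` and `H_♮ⁿ = H ⊗_R ⋯ ⊗_R H`
(`n` factors). -/
def natural : CocyclicData.{w, h} k where
  X := fun n => match n with
    | 0 => ModuleCat.of k R
    | n + 1 => ModuleCat.of k (P.pow n)
  δ := fun n => match n with
    | 0 => P.coface₀
    | n + 1 => P.coface n
  τ := fun n => match n with
    | 0 => LinearMap.id
    | n + 1 => P.cyc n

/-- The cyclic cohomology of a para-Hopf algebroid. -/
abbrev HC (n : ℕ) : Type h := P.natural.HC n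

end ParaHopfAlgebroid

universe u v

open CategoryTheory

/-- A morphism of the groupoid `G`. -/
structure Mor (G : Type u) [Groupoid.{v} G] where
  {src : G}
  {tgt : G}
  hom : src ⟶ tgt

namespace Mor

variable {G : Type u} [Groupoid.{v} G]

/-- The identity of an object. -/
def one (X : G) : Mor G := ⟨𝟙 X⟩

/-- The inverse morphism. -/
def inv (f : Mor G) : Mor G := ⟨Groupoid.inv f.hom⟩

/-- The composition `g ∘ f` (first `f`, then `g`) when the source of `g` is the target of `f`. -/
def comp (g f : Mor G) (hgf : g.src = f.tgt) : Mor G := ⟨f.hom ≫ eqToHom hgf.symm ≫ g.hom⟩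

theorem comp_mk {X Y Z : G} (f : X ⟶ Y) (g : Y ⟶ Z) (hgf : Y = Y) :
    comp ⟨g⟩ ⟨f⟩ hgf = ⟨f ≫ g⟩ := by simp [comp]

theorem one_comp (f : Mor G) (X : G) (hX : X = f.tgt) : comp (one X) f hX = f := by
  subst hX
  exact (comp_mk f.hom (𝟙 _) rfl).trans (by rw [Category.comp_id])

theorem comp_one (f : Mor G) (X : G) (hX : f.src = X) : comp f (one X) hX = f := by
  subst hX
  exact (comp_mk (𝟙 _) f.hom rfl).trans (by rw [Category.id_comp])

theorem comp_assoc (f g l : Mor G) (h₁ : f.src = g.tgt) (h₂ : g.src = l.tgt) :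
    comp (comp f g h₁) l h₂ = comp f (comp g l h₂) h₁ := by
  obtain ⟨f⟩ := f
  obtain ⟨g⟩ := g
  obtain ⟨l⟩ := l
  cases h₁
  cases h₂
  change Mor.mk (l ≫ eqToHom rfl ≫ g ≫ eqToHom rfl ≫ f)
    = Mor.mk ((l ≫ eqToHom rfl ≫ g) ≫ eqToHom rfl ≫ f)
  simp

theorem inv_inv (f : Mor G) : f.inv.inv = f := by
  obtain ⟨f⟩ := f
  simp [inv]

theorem inv_one (X : G) : (one X).inv = one X := by
  simp [inv, one]

theorem inv_comp_self (f : Mor G) : comp f.inv f rfl = one f.src := by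
  obtain ⟨f⟩ := f
  exact (comp_mk f (Groupoid.inv f) rfl).trans (by rw [Groupoid.comp_inv]; rfl)

theorem comp_inv (f g : Mor G) (h : f.src = g.tgt) :
    (comp f g h).inv = comp g.inv f.inv h.symm := by
  obtain ⟨f⟩ := f
  obtain ⟨g⟩ := g
  cases h
  simp [inv, comp]

end Mor

/-- The groupoid algebra `k G`: the free `k`-module on the morphisms of `G`. -/
def GroupoidAlgebra (k : Type w) (G : Type u) [CommRing k] [Groupoid.{v} G] : Type (max u v w) :=
  Mor G →₀ k

noncomputable section

namespace GroupoidAlgebra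

section

variable {k : Type w} {G : Type u} [CommRing k] [Groupoid.{v} G]

instance : AddCommGroup (GroupoidAlgebra k G) := inferInstanceAs (AddCommGroup (Mor G →₀ k))

instance : Module k (GroupoidAlgebra k G) := inferInstanceAs (Module k (Mor G →₀ k))

/-- The basis element of a morphism. -/
def of (g : Mor G) : GroupoidAlgebra k G := Finsupp.single g (1 : k)

/-- The linear map with given values on the morphisms. -/
def extend {N : Type*} [AddCommGroup N] [Module k N] (f : Mor G → N) :
    GroupoidAlgebra k G →ₗ[k] N :=
  Finsupp.linearCombination k f

theorem extend_of {N : Type*} [AddCommGroup N] [Module k N] (f : Mor G → N) (g : Mor G) :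
    extend f (of g : GroupoidAlgebra k G) = f g := by
  refine (Finsupp.linearCombination_single k (1 : k) g).trans (one_smul _ _)

theorem hom_ext {N : Type*} [AddCommGroup N] [Module k N] {φ ψ : GroupoidAlgebra k G →ₗ[k] N}
    (h : ∀ g, φ (of g) = ψ (of g)) : φ = ψ :=
  Finsupp.lhom_ext' fun g => LinearMap.ext_ring (h g)

open Classical in
/-- The product of two morphisms: their composition if it is defined, and `0` otherwise. -/
def mulBasis (g f : Mor G) : GroupoidAlgebra k G :=
  if h : g.src = f.tgt then of (Mor.comp g f h) else 0

/-- The product of the groupoid algebra. -/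
def mulMap : GroupoidAlgebra k G →ₗ[k] GroupoidAlgebra k G →ₗ[k] GroupoidAlgebra k G :=
  extend fun g => extend fun f => mulBasis g f

theorem mulMap_of (g f : Mor G) :
    mulMap (of g) (of f) = (mulBasis g f : GroupoidAlgebra k G) := by
  rw [mulMap, extend_of, extend_of]

@[elab_as_elim]
theorem ind {p : GroupoidAlgebra k G → Prop} (x : GroupoidAlgebra k G) (h0 : p 0)
    (hadd : ∀ x y, p x → p y → p (x + y)) (hsmul : ∀ (c : k) x, p x → p (c • x))
    (hof : ∀ f, p (of f)) : p x := by
  refine Finsupp.induction_linear (motive := p) x h0 hadd fun g c => ?_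
  have : (Finsupp.single g c : Mor G →₀ k) = c • Finsupp.single g 1 := by simp
  rw [this]
  exact hsmul c _ (hof g)

theorem mulBasis_pos {g f : Mor G} (h : g.src = f.tgt) :
    (mulBasis g f : GroupoidAlgebra k G) = of (Mor.comp g f h) := dif_pos h

theorem mulBasis_neg {g f : Mor G} (h : ¬ g.src = f.tgt) :
    (mulBasis g f : GroupoidAlgebra k G) = 0 := dif_neg h

theorem mulMap_assoc (a b c : GroupoidAlgebra k G) :
    mulMap (mulMap a b) c = mulMap a (mulMap b c) := by
  induction a using ind with
  | h0 => simp
  | hadd x y hx hy => simp [hx, hy]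
  | hsmul r x hx => simp [hx]
  | hof f =>
  induction b using ind with
  | h0 => simp
  | hadd x y hx hy => simp [hx, hy]
  | hsmul r x hx => simp [hx]
  | hof g =>
  induction c using ind with
  | h0 => simp
  | hadd x y hx hy => simp [hx, hy]
  | hsmul r x hx => simp [hx]
  | hof l =>
  rw [mulMap_of, mulMap_of]
  by_cases h₁ : f.src = g.tgt <;> by_cases h₂ : g.src = l.tgt
  · rw [mulBasis_pos h₁, mulBasis_pos h₂, mulMap_of, mulMap_of]
    rw [mulBasis_pos (show (Mor.comp f g h₁).src = l.tgt from h₂),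
      mulBasis_pos (show f.src = (Mor.comp g l h₂).tgt from h₁), Mor.comp_assoc]
  · rw [mulBasis_pos h₁, mulBasis_neg h₂, mulMap_of, map_zero]
    exact mulBasis_neg (show ¬ (Mor.comp f g h₁).src = l.tgt from h₂)
  · rw [mulBasis_neg h₁, mulBasis_pos h₂, mulMap_of, map_zero, LinearMap.zero_apply]
    exact (mulBasis_neg (show ¬ f.src = (Mor.comp g l h₂).tgt from h₁)).symm
  · rw [mulBasis_neg h₁, mulBasis_neg h₂]; simp

variable [Fintype G]

/-- The unit `∑_X id_X`. -/
def unit : GroupoidAlgebra k G := ∑ X : G, of (Mor.one X)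

theorem unit_mul (a : GroupoidAlgebra k G) : mulMap unit a = a := by
  induction a using ind with
  | h0 => simp
  | hadd x y hx hy => simp [hx, hy]
  | hsmul r x hx => simp [hx]
  | hof f =>
  rw [unit, map_sum, LinearMap.sum_apply, Finset.sum_eq_single f.tgt]
  · rw [mulMap_of, mulBasis_pos (show (Mor.one f.tgt).src = f.tgt from rfl)]; exact congrArg of (Mor.one_comp f _ rfl)
  · intro X _ hX
    rw [mulMap_of]
    exact mulBasis_neg hX
  · intro h; exact absurd (Finset.mem_univ _) h

theorem mul_unit (a : GroupoidAlgebra k G) : mulMap a unit = a := by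
  induction a using ind with
  | h0 => simp
  | hadd x y hx hy => simp [hx, hy]
  | hsmul r x hx => simp [hx]
  | hof f =>
  rw [unit, map_sum, Finset.sum_eq_single f.src]
  · rw [mulMap_of, mulBasis_pos (show f.src = (Mor.one f.src).tgt from rfl)]; exact congrArg of (Mor.comp_one f _ rfl)
  · intro X _ hX
    rw [mulMap_of]
    exact mulBasis_neg (fun h => hX h.symm)
  · intro h; exact absurd (Finset.mem_univ _) h

instance : Ring (GroupoidAlgebra k G) :=
  { (inferInstance : AddCommGroup (GroupoidAlgebra k G)) with
    mul := fun a b => mulMap a b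
    one := unit
    mul_assoc := mulMap_assoc
    one_mul := unit_mul
    mul_one := mul_unit
    left_distrib := fun a b c => map_add (mulMap a) b c
    right_distrib := fun a b c => by
      change mulMap (a + b) c = mulMap a c + mulMap b c
      rw [map_add, LinearMap.add_apply]
    zero_mul := fun a => by
      change mulMap 0 a = 0
      rw [map_zero, LinearMap.zero_apply]
    mul_zero := fun a => map_zero (mulMap a) }

instance : Algebra k (GroupoidAlgebra k G) :=
  Algebra.ofModule
    (fun c a b => by
      change mulMap (c • a) b = c • mulMap a b
      rw [map_smul, LinearMap.smul_apply])
    (fun c a b => map_smul (mulMap a) c b)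

theorem of_mul_of (g f : Mor G) : (of g * of f : GroupoidAlgebra k G) = mulBasis g f :=
  mulMap_of g f

theorem one_def : (1 : GroupoidAlgebra k G) = ∑ X : G, of (Mor.one X) := rfl

end

/-- The objects of the subgroupoid of identities of `G`: the same objects as `G`. -/
@[ext]
structure Units (G : Type u) : Type u where
  obj : G

instance (G : Type u) [Fintype G] : Fintype (Units G) :=
  Fintype.ofEquiv G ⟨Units.mk, Units.obj, fun _ => rfl, fun _ => rfl⟩

/-- The morphisms of the subgroupoid of identities are the identities of `G`. -/
instance (G : Type u) [Groupoid.{v} G] : Category.{v} (Units G) where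
  Hom X Y := {f : X.obj ⟶ Y.obj // ∃ h : X.obj = Y.obj, f = eqToHom h}
  id X := ⟨𝟙 X.obj, rfl, rfl⟩
  comp f g := ⟨f.1 ≫ g.1, f.2.1.trans g.2.1, by
    obtain ⟨f, hf, rfl⟩ := f
    obtain ⟨g, hg, rfl⟩ := g
    exact eqToHom_trans hf hg⟩
  id_comp f := Subtype.ext (Category.id_comp f.1)
  comp_id f := Subtype.ext (Category.comp_id f.1)
  assoc f g h := Subtype.ext (Category.assoc f.1 g.1 h.1)

instance (G : Type u) [Groupoid.{v} G] : Groupoid.{v} (Units G) where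
  inv f := ⟨Groupoid.inv f.1, f.2.1.symm, by
    obtain ⟨f, hf, rfl⟩ := f
    exact (Groupoid.inv_eq_inv _).trans (inv_eqToHom hf)⟩
  inv_comp f := Subtype.ext (Groupoid.inv_comp f.1)
  comp_inv f := Subtype.ext (Groupoid.comp_inv f.1)

section

variable (k : Type w) (G : Type u) [CommRing k] [Groupoid.{v} G] [Fintype G]

/-- The base algebra `R = k S`, for the subgroupoid `S` of identities. -/
abbrev Base : Type (max u v w) := GroupoidAlgebra k (Units G)

end

variable {k : Type w} {G : Type u} [CommRing k] [Groupoid.{v} G]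

/-- The inclusion of the identities into the morphisms. -/
def inclMor (s : Mor (Units G)) : Mor G := ⟨s.hom.1⟩

/-- The identity of `X`, as a morphism of the subgroupoid of identities. -/
def unitOne (X : G) : Mor (Units G) := Mor.one (⟨X⟩ : Units G)

theorem eq_unitOne (s : Mor (Units G)) : s = unitOne s.src.obj := by
  obtain @⟨⟨X⟩, ⟨Y⟩, ⟨f, hf, e⟩⟩ := s
  cases hf
  cases e
  rfl

theorem inclMor_unitOne (X : G) : inclMor (unitOne X) = Mor.one X := rfl

@[elab_as_elim]
theorem ind_base {p : Base k G → Prop} (x : Base k G) (h0 : p 0)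
    (hadd : ∀ x y, p x → p y → p (x + y)) (hsmul : ∀ (c : k) x, p x → p (c • x))
    (hof : ∀ X : G, p (of (unitOne X))) : p x :=
  ind x h0 hadd hsmul fun s => by rw [eq_unitOne s]; exact hof _

/-- The natural embedding `R = k S → k G`, linearly. -/
def inclLin : Base k G →ₗ[k] GroupoidAlgebra k G := extend fun s => of (inclMor s)

theorem inclLin_of (X : G) :
    inclLin (of (unitOne X)) = (of (Mor.one X) : GroupoidAlgebra k G) := extend_of _ _

variable [Fintype G]

theorem one_mul_of (f : Mor G) : (of (Mor.one f.tgt) * of f : GroupoidAlgebra k G) = of f := by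
  rw [of_mul_of, mulBasis_pos (show (Mor.one f.tgt).src = f.tgt from rfl)]; exact congrArg of (Mor.one_comp f _ rfl)

theorem one_mul_of_ne (X : G) (f : Mor G) (h : ¬ X = f.tgt) :
    (of (Mor.one X) * of f : GroupoidAlgebra k G) = 0 := by
  rw [of_mul_of]; exact mulBasis_neg h

theorem of_mul_one (f : Mor G) : (of f * of (Mor.one f.src) : GroupoidAlgebra k G) = of f := by
  rw [of_mul_of, mulBasis_pos (show f.src = (Mor.one f.src).tgt from rfl)]; exact congrArg of (Mor.comp_one f _ rfl)

theorem of_mul_one_ne (X : G) (f : Mor G) (h : ¬ f.src = X) :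
    (of f * of (Mor.one X) : GroupoidAlgebra k G) = 0 := by
  rw [of_mul_of]; exact mulBasis_neg h

theorem unitOne_mul (X : G) : (of (unitOne X) * of (unitOne X) : Base k G) = of (unitOne X) :=
  one_mul_of (k := k) (unitOne X)

theorem unitOne_mul_ne (X Y : G) (h : ¬ X = Y) :
    (of (unitOne X) * of (unitOne Y) : Base k G) = 0 :=
  one_mul_of_ne (k := k) (⟨X⟩ : Units G) (unitOne Y) (fun e => h (congrArg Units.obj e))

/-- The natural embedding `R = k S → k G`. -/
def incl : Base k G →ₐ[k] GroupoidAlgebra k G :=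
  AlgHom.ofLinearMap inclLin
    (by
      rw [one_def, map_sum, one_def]
      exact Fintype.sum_equiv ⟨Units.obj, Units.mk, fun _ => rfl, fun _ => rfl⟩ _ _
        fun X => inclLin_of X.obj)
    (fun a b => by
      induction a using ind_base with
      | h0 => simp
      | hadd x y hx hy => simp [hx, hy, add_mul]
      | hsmul r x hx => simp [hx]
      | hof X =>
      induction b using ind_base with
      | h0 => simp
      | hadd x y hx hy => simp [hx, hy, mul_add]
      | hsmul r x hx => simp [hx]
      | hof Y =>
      by_cases h : X = Y
      · subst h
        rw [unitOne_mul, inclLin_of]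
        exact (one_mul_of (k := k) (Mor.one X)).symm
      · rw [unitOne_mul_ne X Y h, map_zero, inclLin_of, inclLin_of]
        exact (one_mul_of_ne (k := k) X (Mor.one Y) h).symm)

theorem incl_of (X : G) : incl (of (unitOne X)) = (of (Mor.one X) : GroupoidAlgebra k G) :=
  inclLin_of X

theorem base_comm (a b : Base k G) : a * b = b * a := by
  induction a using ind_base with
  | h0 => simp
  | hadd x y hx hy => simp [hx, hy, add_mul, mul_add]
  | hsmul r x hx => simp [hx]
  | hof X =>
  induction b using ind_base with
  | h0 => simp
  | hadd x y hx hy => simp [hx, hy, add_mul, mul_add]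
  | hsmul r x hx => simp [hx]
  | hof Y =>
  by_cases h : X = Y
  · subst h; rfl
  · rw [unitOne_mul_ne X Y h, unitOne_mul_ne Y X (fun e => h e.symm)]

theorem incl_comm (a b : Base k G) :
    (incl a * incl b : GroupoidAlgebra k G) = incl b * incl a := by
  rw [← map_mul, base_comm, map_mul]

variable (k G) in
/-- Source and target maps: `α = β` is the natural embedding. -/
def baseData : BaseData k (Base k G) (GroupoidAlgebra k G) where
  α := incl
  β := incl.toOpposite incl_comm
  comm := incl_comm

theorem tgt_eq (r : Base k G) : (baseData k G).tgt r = incl r := rfl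

/-- `Δ(g) = g ⊗_R g`. -/
def comulMap : GroupoidAlgebra k G →ₗ[k] (baseData k G).Tens (baseData k G).self :=
  extend fun g => (baseData k G).tmul (baseData k G).self (of g) (of g : GroupoidAlgebra k G)

theorem comulMap_of (g : Mor G) :
    comulMap (of g) = (baseData k G).tmul (baseData k G).self (of g)
      (of g : GroupoidAlgebra k G) := extend_of _ _

theorem comulMap_left (r : Base k G) (x : GroupoidAlgebra k G) :
    comulMap (incl r * x) = (baseData k G).lact (baseData k G).self r (comulMap x) := by
  induction r using ind_base with
  | h0 => simp [BaseData.lact_zero]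
  | hadd a b ha hb => simp [BaseData.lact_add, add_mul, ha, hb]
  | hsmul c a ha => simp [BaseData.lact_smul, ha]
  | hof X =>
    induction x using ind with
    | h0 => simp
    | hadd a b ha hb => simp only [mul_add, map_add, ha, hb]
    | hsmul c a ha => simp only [mul_smul_comm, map_smul, ha]
    | hof g =>
      rw [comulMap_of, BaseData.lact_tmul]
      change _ = (baseData k G).tmul (baseData k G).self (incl _ * of g) _
      rw [incl_of]
      by_cases h : X = g.tgt
      · subst h; rw [one_mul_of, comulMap_of]
      · rw [one_mul_of_ne X g h]; simp

theorem comulMap_right (r : Base k G) (x : GroupoidAlgebra k G) :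
    comulMap (incl r * x) = (baseData k G).ractR r (comulMap x) := by
  rw [comulMap_left]
  induction x using ind with
  | h0 => simp
  | hadd a b ha hb => simp only [map_add, ha, hb]
  | hsmul c a ha => simp only [map_smul, ha]
  | hof g =>
    rw [comulMap_of, BaseData.lact_tmul]
    exact (baseData k G).tmul_tgt (baseData k G).self r (of g) (of g : GroupoidAlgebra k G)

variable (k G) in
/-- The coproduct of the groupoid algebra. -/
def coringData : CoringData k (Base k G) (GroupoidAlgebra k G) where
  toBaseData := baseData k G
  Δ := comulMap
  Δ_left := comulMap_left
  Δ_right := comulMap_right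

theorem takeuchi (a : GroupoidAlgebra k G) (r : Base k G) :
    (baseData k G).ractH (incl r ⊗ₜ 1 - 1 ⊗ₜ incl r) (comulMap a) = 0 := by
  induction a using ind with
  | h0 => simp
  | hadd a b ha hb => rw [map_add, map_add, ha, hb, add_zero]
  | hsmul c a ha => rw [map_smul, map_smul, ha, smul_zero]
  | hof g =>
    rw [BaseData.ractH_sub, LinearMap.sub_apply, sub_eq_zero, comulMap_of,
      BaseData.ractH_tmul, BaseData.ractH_tmul, mul_one]
    induction r using ind_base with
    | h0 => simp
    | hadd a b ha hb => simp only [map_add, mul_add, LinearMap.add_apply, ha, hb]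
    | hsmul c a ha => simp only [map_smul, mul_smul_comm, LinearMap.smul_apply, ha]
    | hof X =>
      rw [incl_of]
      by_cases h : g.src = X
      · subst h; rw [of_mul_one]
      · rw [of_mul_one_ne X g h]; simp

theorem ractH_rel (a : GroupoidAlgebra k G)
    (v : GroupoidAlgebra k G ⊗[k] GroupoidAlgebra k G)
    (hv : v ∈ (baseData k G).rel (baseData k G).self) :
    (baseData k G).ractH v (comulMap a) = 0 := by
  refine Submodule.span_induction (p := fun v _ => (baseData k G).ractH v (comulMap a) = 0)
    ?_ ?_ ?_ ?_ hv
  · rintro _ ⟨r, x, y, rfl⟩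
    have e : (((baseData k G).tgt r * x) ⊗ₜ[k] y - x ⊗ₜ[k] (baseData k G).self.act r y :
        GroupoidAlgebra k G ⊗[k] GroupoidAlgebra k G)
        = (incl r ⊗ₜ 1 - 1 ⊗ₜ incl r) * (x ⊗ₜ[k] (y : GroupoidAlgebra k G)) := by
      rw [sub_mul, Algebra.TensorProduct.tmul_mul_tmul, Algebra.TensorProduct.tmul_mul_tmul,
        one_mul, one_mul]
      rfl
    exact (congrArg (fun w => (baseData k G).ractH w (comulMap a)) e).trans
      (by rw [BaseData.ractH_mul, takeuchi, map_zero])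
  · have := (baseData k G).ractH_smul 0 0
    rw [zero_smul, zero_smul] at this
    rw [this, LinearMap.zero_apply]
  · intro x y _ _ hx hy
    rw [BaseData.ractH_add, LinearMap.add_apply, hx, hy, add_zero]
  · intro c x _ hx
    rw [BaseData.ractH_smul, LinearMap.smul_apply, hx, smul_zero]

theorem exists_rep (b : GroupoidAlgebra k G) :
    ∃ v : GroupoidAlgebra k G ⊗[k] GroupoidAlgebra k G,
      (baseData k G).proj (baseData k G).self v = comulMap b ∧
      ∀ a, comulMap (a * b) = (baseData k G).ractH v (comulMap a) := by
  induction b using ind with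
  | h0 =>
    refine ⟨0, by rw [map_zero, map_zero], fun a => ?_⟩
    rw [mul_zero, map_zero, ractH_rel a 0 (zero_mem _)]
  | hadd x y hx hy =>
    obtain ⟨v, hv, hv'⟩ := hx
    obtain ⟨w, hw, hw'⟩ := hy
    refine ⟨v + w, by rw [map_add, map_add]; exact congrArg₂ (· + ·) hv hw, fun a => ?_⟩
    rw [mul_add, map_add, hv', hw', BaseData.ractH_add]; rfl
  | hsmul c x hx =>
    obtain ⟨v, hv, hv'⟩ := hx
    refine ⟨c • v, by rw [map_smul, map_smul]; exact congrArg (c • ·) hv, fun a => ?_⟩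
    rw [mul_smul_comm, map_smul, hv', BaseData.ractH_smul]; rfl
  | hof f =>
    refine ⟨of f ⊗ₜ of f, (comulMap_of f).symm, fun a => ?_⟩
    induction a using ind with
    | h0 => simp
    | hadd a b ha hb => rw [add_mul, map_add, map_add, map_add, ha, hb]
    | hsmul c a ha => rw [smul_mul_assoc, map_smul, map_smul, map_smul, ha]
    | hof g =>
      rw [comulMap_of, BaseData.ractH_tmul, of_mul_of]
      by_cases h : g.src = f.tgt
      · rw [mulBasis_pos h, comulMap_of]
      · rw [mulBasis_neg h]; simp

theorem comulMap_mul (a b : GroupoidAlgebra k G)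
    (v : GroupoidAlgebra k G ⊗[k] GroupoidAlgebra k G)
    (hv : (baseData k G).proj (baseData k G).self v = comulMap b) :
    comulMap (a * b) = (baseData k G).ractH v (comulMap a) := by
  obtain ⟨w, hw, hw'⟩ := exists_rep b
  rw [hw' a, ← sub_eq_zero, ← LinearMap.sub_apply, ← BaseData.ractH_sub]
  exact ractH_rel a _ ((Submodule.Quotient.eq _).1 (hw.trans hv.symm))

theorem descend {N : Type*} [AddCommGroup N] [Module k N]
    (L : GroupoidAlgebra k G →ₗ[k] GroupoidAlgebra k G →ₗ[k] N)
    (hL : ∀ (r : Base k G) x y, L (incl r * x) y = L x (incl r * y))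
    (F : GroupoidAlgebra k G →ₗ[k] N) (hF : ∀ g, L (of g) (of g) = F (of g))
    (x : GroupoidAlgebra k G) (v : GroupoidAlgebra k G ⊗[k] GroupoidAlgebra k G)
    (hv : (baseData k G).proj (baseData k G).self v = comulMap x) :
    TensorProduct.lift L v = F x := by
  have hr : (baseData k G).rel (baseData k G).self ≤ LinearMap.ker (TensorProduct.lift L) := by
    refine Submodule.span_le.2 ?_
    rintro _ ⟨r, x, y, rfl⟩
    refine LinearMap.mem_ker.2 ?_
    rw [map_sub, sub_eq_zero]
    exact hL r x y
  have key : (((baseData k G).rel (baseData k G).self).liftQ (TensorProduct.lift L) hr).comp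
      comulMap = F := hom_ext fun g => by
    rw [LinearMap.comp_apply, comulMap_of]
    exact hF g
  rw [← key, LinearMap.comp_apply, ← hv]
  rfl

/-- `ε(g) = id_{target(g)}`. -/
def counitMap : GroupoidAlgebra k G →ₗ[k] Base k G := extend fun g => of (unitOne g.tgt)

theorem counitMap_of (g : Mor G) :
    counitMap (of g) = (of (unitOne g.tgt) : Base k G) := extend_of _ _

theorem counitMap_left (r : Base k G) (x : GroupoidAlgebra k G) :
    counitMap (incl r * x) = r * counitMap x := by
  induction r using ind_base with
  | h0 => simp
  | hadd a b ha hb => simp [add_mul, ha, hb]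
  | hsmul c a ha => simp [ha]
  | hof X =>
    induction x using ind with
    | h0 => simp
    | hadd a b ha hb => simp [mul_add, ha, hb]
    | hsmul c a ha => simp [ha]
    | hof g =>
      rw [incl_of, counitMap_of]
      by_cases h : X = g.tgt
      · subst h; rw [one_mul_of, counitMap_of, unitOne_mul]
      · rw [one_mul_of_ne X g h, unitOne_mul_ne X g.tgt h, map_zero]

variable (k G) in
/-- The bialgebroid structure of the groupoid algebra. -/
def bialgebroid : Bialgebroid k (Base k G) (GroupoidAlgebra k G) where
  toCoringData := coringData k G
  Δ_one := by
    change comulMap 1 = (baseData k G).tmul (baseData k G).self 1 (1 : GroupoidAlgebra k G)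
    refine (map_sum comulMap _ _).trans ((Finset.sum_congr rfl fun X _ => ?_).trans
      (map_sum ((baseData k G).tmul (baseData k G).self 1)
        (fun X : G => (of (Mor.one X) : GroupoidAlgebra k G)) Finset.univ).symm)
    rw [comulMap_of]
    have e := (baseData k G).tmul_tgt (baseData k G).self (of (unitOne X)) 1
      (of (Mor.one X) : GroupoidAlgebra k G)
    have e₁ : (baseData k G).tgt (of (unitOne X)) * 1 = of (Mor.one X) :=
      (mul_one _).trans (incl_of X)
    have e₂ : (baseData k G).self.act (of (unitOne X)) (of (Mor.one X) : GroupoidAlgebra k G)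
        = (of (Mor.one X) : GroupoidAlgebra k G) :=
      (congrArg (· * (of (Mor.one X) : GroupoidAlgebra k G)) (incl_of X)).trans
        (one_mul_of (Mor.one X))
    rw [e₁, e₂] at e
    exact e
  coassoc x := by
    have key : ((coringData k G).comulTens (baseData k G).self).map.comp comulMap
        = ((baseData k G).idTens (coringData k G).comul).map.comp comulMap :=
      hom_ext fun g => by
        have e₁ : ((coringData k G).comulTens (baseData k G).self).map
              ((baseData k G).tmul (baseData k G).self (of g) (of g : GroupoidAlgebra k G))
            = (coringData k G).assoc (baseData k G).self (comulMap (of g))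
              (of g : GroupoidAlgebra k G) := rfl
        have e₂ : ((baseData k G).idTens (coringData k G).comul).map
              ((baseData k G).tmul (baseData k G).self (of g) (of g : GroupoidAlgebra k G))
            = (baseData k G).tmul ((baseData k G).tens (baseData k G).self) (of g)
              (comulMap (of g)) := rfl
        refine (congrArg _ (comulMap_of g)).trans (e₁.trans ?_)
        refine Eq.trans ?_ (e₂.symm.trans (congrArg _ (comulMap_of g).symm))
        rw [comulMap_of]
        rfl
    exact LinearMap.congr_fun key x
  Δ_takeuchi := takeuchi
  Δ_mul := comulMap_mul
  ε := counitMap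
  ε_left := counitMap_left
  ε_right r x := (counitMap_left r x).trans (base_comm _ _)
  ε_one := by
    rw [one_def, map_sum, one_def]
    exact (Fintype.sum_equiv ⟨Units.obj, Units.mk, fun _ => rfl, fun _ => rfl⟩ _ _
      fun X => (counitMap_of (Mor.one X.obj)).symm).symm
  counit_left x v hv := by
    refine descend _ (fun r x y => ?_) LinearMap.id (fun g => ?_) x v hv
    · change incl (counitMap (incl r * x)) * y = incl (counitMap x) * (incl r * y)
      rw [counitMap_left, base_comm, map_mul, mul_assoc]
    · change incl (counitMap (of g)) * of g = of g
      rw [counitMap_of, incl_of, one_mul_of]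
  counit_right x v hv := by
    refine descend _ (fun r x y => ?_) LinearMap.id (fun g => ?_) x v hv
    · change incl (counitMap y) * (incl r * x) = incl (counitMap (incl r * y)) * x
      rw [counitMap_left, base_comm, map_mul, mul_assoc]
    · change incl (counitMap (of g)) * of g = of g
      rw [counitMap_of, incl_of, one_mul_of]

/-- `T(g) = g⁻¹`, linearly. -/
def invMap : GroupoidAlgebra k G →ₗ[k] GroupoidAlgebra k G := extend fun g => of g.inv

theorem invMap_of (g : Mor G) : invMap (of g) = (of g.inv : GroupoidAlgebra k G) :=
  extend_of _ _

theorem invMap_one : invMap (1 : GroupoidAlgebra k G) = 1 := by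
  rw [one_def, map_sum]
  exact Finset.sum_congr rfl fun X _ => by rw [invMap_of, Mor.inv_one]

theorem invMap_mul (a b : GroupoidAlgebra k G) : invMap (a * b) = invMap b * invMap a := by
  induction a using ind with
  | h0 => simp
  | hadd x y hx hy => simp [add_mul, mul_add, hx, hy]
  | hsmul c x hx => simp [hx]
  | hof f =>
    induction b using ind with
    | h0 => simp
    | hadd x y hx hy => simp [add_mul, mul_add, hx, hy]
    | hsmul c x hx => simp [hx]
    | hof g =>
      rw [invMap_of, invMap_of, of_mul_of, of_mul_of]
      by_cases h : f.src = g.tgt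
      · rw [mulBasis_pos h, mulBasis_pos (show g.inv.src = f.inv.tgt from h.symm), invMap_of,
          Mor.comp_inv]
      · rw [mulBasis_neg h, mulBasis_neg (show ¬ g.inv.src = f.inv.tgt from fun e => h e.symm),
          map_zero]

theorem invMap_invMap (a : GroupoidAlgebra k G) : invMap (invMap a) = a := by
  induction a using ind with
  | h0 => simp
  | hadd x y hx hy => simp [hx, hy]
  | hsmul c x hx => simp [hx]
  | hof f => rw [invMap_of, invMap_of, Mor.inv_inv]

theorem invMap_incl (r : Base k G) : invMap (incl r) = (incl r : GroupoidAlgebra k G) := by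
  induction r using ind_base with
  | h0 => simp
  | hadd x y hx hy => simp [hx, hy]
  | hsmul c x hx => simp [hx]
  | hof X => rw [incl_of, invMap_of, Mor.inv_one]

/-- `T(g) = g⁻¹`, as an algebra anti-homomorphism. -/
def invHom : GroupoidAlgebra k G →ₐ[k] (GroupoidAlgebra k G)ᵐᵒᵖ :=
  AlgHom.ofLinearMap ((MulOpposite.opLinearEquiv k).toLinearMap.comp invMap)
    (congrArg MulOpposite.op invMap_one) (fun a b => congrArg MulOpposite.op (invMap_mul a b))

theorem inv_mul_of (g : Mor G) :
    (of g.inv * of g : GroupoidAlgebra k G) = of (Mor.one g.src) := by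
  rw [of_mul_of, mulBasis_pos (show g.inv.src = g.tgt from rfl), Mor.inv_comp_self]

variable (k G) in
/-- The para-Hopf algebroid structure of the groupoid algebra `k G` over `R = k S`:
`α = β` is the natural embedding, `Δ(g) = g ⊗_R g`, `ε(g) = id_{target(g)}`, `T(g) = g⁻¹`. -/
def paraHopf : ParaHopfAlgebroid k (Base k G) (GroupoidAlgebra k G) where
  toBialgebroid := bialgebroid k G
  T := invHom
  T_tgt := invMap_incl
  T_mul x v hv := by
    refine descend _ (fun r x y => ?_) (incl.toLinearMap.comp (counitMap.comp invMap))
      (fun g => ?_) x v hv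
    · change invMap (incl r * x) * y = invMap x * (incl r * y)
      rw [invMap_mul, invMap_incl, mul_assoc]
    · change invMap (of g) * of g = incl (counitMap (invMap (of g)))
      rw [invMap_of, inv_mul_of, counitMap_of, incl_of]
      rfl
  T_T := invMap_invMap
  T_comul h n x y hxy := by
    let L : GroupoidAlgebra k G →ₗ[k] GroupoidAlgebra k G →ₗ[k]
        (baseData k G).Tens (baseData k G).self :=
      LinearMap.mk₂ k (fun x y => (baseData k G).ractH (y ⊗ₜ 1) (comulMap (invMap x)))
        (fun x x' y => by simp only [map_add])
        (fun c x y => by simp only [map_smul])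
        (fun x y y' => by
          rw [TensorProduct.add_tmul, BaseData.ractH_add, LinearMap.add_apply])
        (fun c x y => by
          rw [← TensorProduct.smul_tmul', BaseData.ractH_smul, LinearMap.smul_apply])
    have key := descend L (fun r x y => ?_)
      (((baseData k G).tmul (baseData k G).self 1).comp invMap) (fun g => ?_) h
      (∑ i, x i ⊗ₜ y i) ((map_sum _ _ _).trans hxy)
    · rw [map_sum] at key
      exact key
    · change (baseData k G).ractH (y ⊗ₜ 1) (comulMap (invMap (incl r * x)))
        = (baseData k G).ractH ((incl r * y) ⊗ₜ 1) (comulMap (invMap x))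
      have e : ((incl r * y) ⊗ₜ 1 : GroupoidAlgebra k G ⊗[k] GroupoidAlgebra k G)
          = (incl r ⊗ₜ 1) * (y ⊗ₜ 1) := by
        rw [Algebra.TensorProduct.tmul_mul_tmul, one_mul]
      rw [invMap_mul, invMap_incl, e, BaseData.ractH_mul]
      exact congrArg _ (Bialgebroid.Δ_mul_src (B := bialgebroid k G) (invMap x) r)
    · change (baseData k G).ractH (of g ⊗ₜ 1) (comulMap (invMap (of g)))
        = (baseData k G).tmul (baseData k G).self 1 (invMap (of g))
      rw [invMap_of, comulMap_of, BaseData.ractH_tmul, mul_one, inv_mul_of]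
      have e := (baseData k G).tmul_tgt (baseData k G).self (of (unitOne g.src)) 1
        (of g.inv : GroupoidAlgebra k G)
      have e₁ : (baseData k G).tgt (of (unitOne g.src)) * 1 = of (Mor.one g.src) :=
        (mul_one _).trans (incl_of g.src)
      have e₂ : (baseData k G).self.act (of (unitOne g.src)) (of g.inv : GroupoidAlgebra k G)
          = (of g.inv : GroupoidAlgebra k G) :=
        (congrArg (· * (of g.inv : GroupoidAlgebra k G)) (incl_of g.src)).trans
          (one_mul_of g.inv)
      rw [e₁, e₂] at e
      exact e

end GroupoidAlgebra

end

/-! The proof rests on homogeneous coordinates. As `R` is spanned by the orthogonal idempotents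
`id_X`, `H_♮ⁿ` is spanned by tensors of `n` morphisms with one common target. Such a tensor can be
written `x₀⁻¹x₁ ⊗ ⋯ ⊗ x₀⁻¹x_n` with `x₀, …, x_n` of common target (for instance with `x₀` an
identity); this is `elt`. In these coordinates `δ_i` doubles `x_i` for `i ≤ n`, `δ_{n+1}` appends a
copy of `x₀`, and `τ_n` rotates (`cof_elt`, `tau_elt`). The cocyclic identities become comparisons
of indices (`natural_identities`), and they imply that the total differential squares to zero
(`Identities.d_comp_d`).

The columns are contracted by two maps `s` with `s δ₀ = id` and `s δ_{i+1} = δ_i s`. Deleting `x₀`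
(`del`) satisfies this for all cofaces but the last, which is enough for `b'`: the odd columns are
exact, in degree `0` too. Deleting `x₀` if `x₀ = x₁` and giving `0` otherwise (`delEq`) satisfies it
for the last coface as well, which makes the even columns exact in positive degrees; in degree `0`,
`b = δ₀ - δ₁ = 0`. So an even column has only the cohomology `R`, in degree `0`, and an odd column
has none (`natural_exactColumns`).

It remains to pass from columns to the total complex. By exactness of the columns a cocycle of
degree `n` can be pushed down, modulo coboundaries, into `C^{n,0}` (`exists_boundary`). If `n` is
odd, injectivity of `b'` on `X 0` then forces it to vanish. If `n` is even, every element of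
`C^{n,0} = R` is a cocycle; it is a coboundary only if it is zero, because the same descent shows
that its primitive, of odd degree, is already closed. -/

namespace CocyclicData

/-! ### The relations between `b`, `b'`, `1 - λ` and `N` in the cyclic bicomplex. -/

variable {k : Type w} [CommRing k] (X : CocyclicData.{w, h} k)

/-- The coface `δ_i`, indexed by natural numbers (`0` beyond the range). -/
noncomputable def cof (n i : ℕ) : X.X n →ₗ[k] X.X (n + 1) :=
  if h : i < n + 2 then X.δ n ⟨i, h⟩ else 0

theorem b_eq_sum (n : ℕ) : X.b n = ∑ i ∈ Finset.range (n + 2), (-1 : k) ^ i • X.cof n i := by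
  rw [b, ← Fin.sum_univ_eq_sum_range (fun i => (-1 : k) ^ i • X.cof n i) (n + 2)]
  exact Finset.sum_congr rfl fun i _ => by rw [cof, dif_pos i.2]

theorem b'_eq_sum (n : ℕ) : X.b' n = ∑ i ∈ Finset.range (n + 1), (-1 : k) ^ i • X.cof n i := by
  rw [b', ← Fin.sum_univ_eq_sum_range (fun i => (-1 : k) ^ i • X.cof n i) (n + 1)]
  exact Finset.sum_congr rfl fun i _ => by
    rw [cof, dif_pos (show (i : ℕ) < n + 2 by omega)]; rfl

/-- The identities of a cocyclic module that involve only cofaces and cyclic operators. -/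
structure Identities : Prop where
  cof_cof : ∀ n i j, i ≤ j → j ≤ n + 1 →
    X.cof (n + 1) (j + 1) ∘ₗ X.cof n i = X.cof (n + 1) i ∘ₗ X.cof n j
  tau_cof_succ : ∀ n i, i ≤ n → X.τ (n + 1) ∘ₗ X.cof n (i + 1) = X.cof n i ∘ₗ X.τ n
  tau_cof_zero : ∀ n, X.τ (n + 1) ∘ₗ X.cof n 0 = X.cof n (n + 1)
  tau_pow : ∀ n, X.τ n ^ (n + 1) = 1

theorem comp_sum {ι M N P : Type*} [AddCommGroup M] [AddCommGroup N] [AddCommGroup P] [Module k M]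
    [Module k N] [Module k P] (g : N →ₗ[k] P) (s : Finset ι) (f : ι → M →ₗ[k] N) :
    g ∘ₗ ∑ i ∈ s, f i = ∑ i ∈ s, g ∘ₗ f i := by
  ext; simp

theorem sum_comp {ι M N P : Type*} [AddCommGroup M] [AddCommGroup N] [AddCommGroup P] [Module k M]
    [Module k N] [Module k P] (s : Finset ι) (f : ι → N →ₗ[k] P) (g : M →ₗ[k] N) :
    (∑ i ∈ s, f i) ∘ₗ g = ∑ i ∈ s, f i ∘ₗ g := by
  ext; simp

/-- The double alternating sum in `d ∘ d` vanishes. -/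
theorem alternating_sum_eq_zero {M : Type*} [AddCommGroup M] [Module k M] (N : ℕ)
    (F : ℕ → ℕ → M) (hF : ∀ i j, i ≤ j → j ≤ N → F (j + 1) i = F i j) :
    ∑ j ∈ Finset.range (N + 2), ∑ i ∈ Finset.range (N + 1), (-1 : k) ^ j • (-1 : k) ^ i • F j i
      = 0 := by
  rw [← Finset.sum_product']
  -- The terms `(j + 1, i)` and `(i, j)` with `i ≤ j` are paired: their values agree by `hF`, and
  -- their signs are opposite.
  refine Finset.sum_involution
    (fun p _ => if p.2 < p.1 then (p.2, p.1 - 1) else (p.2 + 1, p.1)) ?_ ?_ ?_ ?_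
  · rintro ⟨j, i⟩ hp
    simp only [Finset.mem_product, Finset.mem_range] at hp
    by_cases hij : i < j
    · obtain ⟨j, rfl⟩ : ∃ j', j = j' + 1 := ⟨j - 1, by omega⟩
      simp only [hij, if_true, Nat.add_sub_cancel, hF i j (by omega) (by omega), smul_smul]
      rw [← add_smul, pow_succ]
      convert zero_smul k _
      ring
    · simp only [hij, if_false, hF j i (by omega) (by omega), smul_smul]
      rw [← add_smul, pow_succ]
      convert zero_smul k _
      ring
  · rintro ⟨j, i⟩ hp _ h
    dsimp only at h
    split_ifs at h with hij <;> simp only [Prod.mk.injEq] at h <;> omega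
  · rintro ⟨j, i⟩ hp
    simp only [Finset.mem_product, Finset.mem_range] at hp ⊢
    split_ifs with hij <;> constructor <;> dsimp only at hij ⊢ <;> omega
  · rintro ⟨j, i⟩ hp
    by_cases hij : i < j
    · have : ¬ j - 1 < i := by omega
      simp only [hij, if_true, this, if_false, Prod.mk.injEq, and_true]
      omega
    · have : j < i + 1 := by omega
      simp only [hij, if_false, this, if_true, Prod.mk.injEq, true_and]
      omega

theorem alternating_sum_comp_eq_zero {M N P : Type*} [AddCommGroup M] [AddCommGroup N]
    [AddCommGroup P] [Module k M] [Module k N] [Module k P] (n : ℕ) (f : ℕ → N →ₗ[k] P)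
    (g : ℕ → M →ₗ[k] N) (h : ∀ i j, i ≤ j → j ≤ n → f (j + 1) ∘ₗ g i = f i ∘ₗ g j) :
    (∑ j ∈ Finset.range (n + 2), (-1 : k) ^ j • f j) ∘ₗ
      (∑ i ∈ Finset.range (n + 1), (-1 : k) ^ i • g i) = 0 := by
  rw [← alternating_sum_eq_zero (k := k) n (fun j i => f j ∘ₗ g i) h, sum_comp]
  refine Finset.sum_congr rfl fun j _ => ?_
  rw [comp_sum]
  refine Finset.sum_congr rfl fun i _ => ?_
  rw [LinearMap.comp_smul, LinearMap.smul_comp, smul_comm]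

variable {X}

namespace Identities

variable (I : X.Identities)
include I

theorem b_comp_b (n : ℕ) : X.b (n + 1) ∘ₗ X.b n = 0 := by
  rw [b_eq_sum, b_eq_sum]
  exact alternating_sum_comp_eq_zero (n + 1) _ _ fun i j hij hj => I.cof_cof n i j hij hj

theorem b'_comp_b' (n : ℕ) : X.b' (n + 1) ∘ₗ X.b' n = 0 := by
  rw [b'_eq_sum, b'_eq_sum]
  exact alternating_sum_comp_eq_zero n _ _ fun i j hij hj => I.cof_cof n i j hij (by omega)

/-- The sign `(-1)^{n(n+1)}` is `1`, so the signed operator keeps the order of `τ`. -/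
theorem lam_pow (n : ℕ) : X.lam n ^ (n + 1) = 1 := by
  rw [lam, smul_pow, I.tau_pow, ← pow_mul, (Nat.even_mul_succ_self n).neg_one_pow, one_smul]

theorem norm_mul_lam (n : ℕ) : X.norm n * X.lam n = X.norm n := by
  have := geom_sum_mul_neg (X.lam n) (n + 1)
  rw [I.lam_pow, sub_self, mul_sub, mul_one, sub_eq_zero] at this
  exact this.symm

theorem lam_mul_norm (n : ℕ) : X.lam n * X.norm n = X.norm n := by
  have := mul_neg_geom_sum (X.lam n) (n + 1)
  rw [I.lam_pow, sub_self, sub_mul, one_mul, sub_eq_zero] at this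
  exact this.symm

theorem norm_mul_lam_pow (n i : ℕ) : X.norm n * X.lam n ^ i = X.norm n := by
  induction i with
  | zero => rw [pow_zero, mul_one]
  | succ i ih => rw [pow_succ, ← mul_assoc, ih, I.norm_mul_lam]

theorem lam_pow_mul_norm (n i : ℕ) : X.lam n ^ i * X.norm n = X.norm n := by
  induction i with
  | zero => rw [pow_zero, one_mul]
  | succ i ih => rw [pow_succ, mul_assoc, I.lam_mul_norm, ih]

theorem lam_comp_cof_succ (n i : ℕ) (hi : i ≤ n) :
    X.lam (n + 1) ∘ₗ ((-1 : k) ^ (i + 1) • X.cof n (i + 1))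
      = ((-1 : k) ^ i • X.cof n i) ∘ₗ X.lam n := by
  rw [lam, lam, LinearMap.comp_smul, LinearMap.smul_comp, LinearMap.smul_comp,
    LinearMap.comp_smul, I.tau_cof_succ n i hi, smul_smul, smul_smul]
  congr 1
  ring

theorem lam_comp_cof_zero (n : ℕ) :
    X.lam (n + 1) ∘ₗ X.cof n 0 = (-1 : k) ^ (n + 1) • X.cof n (n + 1) := by
  rw [lam, LinearMap.smul_comp, I.tau_cof_zero]

/-- Absorbing the signs into `λ` and the cofaces makes every signed coface a conjugate `λ⁻ⁱ δ₀ λⁱ`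
of the zeroth one, including the last. -/
theorem lam_pow_comp_cof (n i : ℕ) (hi : i ≤ n + 1) :
    (X.lam (n + 1) ^ i) ∘ₗ ((-1 : k) ^ i • X.cof n i) = X.cof n 0 ∘ₗ (X.lam n ^ i) := by
  induction i with
  | zero => rw [pow_zero, pow_zero, pow_zero, one_smul]; rfl
  | succ i ih =>
    rw [pow_succ (X.lam (n + 1)), Module.End.mul_eq_comp, LinearMap.comp_assoc,
      I.lam_comp_cof_succ n i (by omega), ← LinearMap.comp_assoc, ih (by omega), pow_succ,
      Module.End.mul_eq_comp, LinearMap.comp_assoc]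

/-- Composing with `λ` lowers the index of each coface by one, except that `δ₀` becomes the last
coface. This extra term is exactly the difference between `b` and `b'`, so it cancels. -/
theorem one_sub_lam_comp_b (n : ℕ) :
    (1 - X.lam (n + 1)) ∘ₗ X.b n = X.b' n ∘ₗ (1 - X.lam n) := by
  have h₁ : X.lam (n + 1) ∘ₗ X.b n
      = X.b' n ∘ₗ X.lam n + (-1 : k) ^ (n + 1) • X.cof n (n + 1) := by
    rw [b_eq_sum, comp_sum, Finset.sum_range_succ', b'_eq_sum, sum_comp,
      pow_zero, one_smul, I.lam_comp_cof_zero]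
    congr 1
    exact Finset.sum_congr rfl fun i hi => I.lam_comp_cof_succ n i (by
      have := Finset.mem_range.1 hi; omega)
  have h₂ : X.b n = X.b' n + (-1 : k) ^ (n + 1) • X.cof n (n + 1) := by
    rw [b_eq_sum, b'_eq_sum, Finset.sum_range_succ]
  rw [LinearMap.sub_comp, LinearMap.comp_sub, h₁, h₂]
  change _ - _ = X.b' n - _
  rw [Module.End.one_eq_id, LinearMap.id_comp]
  abel

/-- Both sides equal `N δ₀ N`. On the left, `N` absorbs the factors `λ⁻ⁱ` of the conjugates `λ⁻ⁱ δ₀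
λⁱ`, and the `λⁱ` add up to the other norm; on the right the roles are exchanged. -/
theorem norm_comp_b' (n : ℕ) : X.norm (n + 1) ∘ₗ X.b' n = X.b n ∘ₗ X.norm n := by
  have h₁ : X.norm (n + 1) ∘ₗ X.b' n = X.norm (n + 1) ∘ₗ X.cof n 0 ∘ₗ X.norm n := by
    rw [b'_eq_sum, comp_sum]
    conv_rhs => rw [norm.eq_def X n, comp_sum, comp_sum]
    refine Finset.sum_congr rfl fun i hi => ?_
    have hi' := Finset.mem_range.1 hi
    rw [← I.lam_pow_comp_cof n i (by omega), ← LinearMap.comp_assoc, ← Module.End.mul_eq_comp,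
      I.norm_mul_lam_pow]
  -- The power of `λ` is `λ⁻ⁱ = λ^{n+2-i}`, split so that reflecting the sum gives `N λ = N`.
  have h₂ : ∀ i ∈ Finset.range (n + 2), ((-1 : k) ^ i • X.cof n i) ∘ₗ X.norm n
      = (X.lam (n + 1) ^ (n + 2 - 1 - i) * X.lam (n + 1)) ∘ₗ X.cof n 0 ∘ₗ X.norm n := by
    intro i hi
    have hi' := Finset.mem_range.1 hi
    conv_rhs => rw [← I.lam_pow_mul_norm n i]
    rw [Module.End.mul_eq_comp (X.lam n ^ i), ← LinearMap.comp_assoc (X.norm n),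
      ← I.lam_pow_comp_cof n i (by omega), LinearMap.comp_assoc, ← LinearMap.comp_assoc,
      ← Module.End.mul_eq_comp, mul_assoc, ← pow_succ', ← pow_add,
      show n + 2 - 1 - i + (i + 1) = n + 1 + 1 by omega, I.lam_pow]
    rfl
  rw [h₁, b_eq_sum, sum_comp, Finset.sum_congr rfl h₂, ← sum_comp,
    ← Finset.sum_mul, Finset.sum_range_reflect (fun i => X.lam (n + 1) ^ i) (n + 2)]
  exact congrArg (· ∘ₗ X.cof n 0 ∘ₗ X.norm n) (I.norm_mul_lam (n + 1)).symm

theorem vert_comp_vert (p q : ℕ) : X.vert p (q + 1) ∘ₗ X.vert p q = 0 := by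
  rw [vert, vert]
  split_ifs
  · exact I.b_comp_b q
  · rw [LinearMap.neg_comp, LinearMap.comp_neg, neg_neg, I.b'_comp_b']

theorem horiz_comp_horiz (p q : ℕ) : X.horiz (p + 1) q ∘ₗ X.horiz p q = 0 := by
  rw [horiz, horiz]
  by_cases hp : Even p
  · rw [if_pos hp, if_neg (by simpa [Nat.even_add_one] using hp)]
    change X.norm q * (1 - X.lam q) = 0
    rw [mul_sub, mul_one, I.norm_mul_lam, sub_self]
  · rw [if_neg hp, if_pos (by simpa [Nat.even_add_one] using hp)]
    change (1 - X.lam q) * X.norm q = 0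
    rw [sub_mul, one_mul, I.lam_mul_norm, sub_self]

theorem horiz_comp_vert (p q : ℕ) :
    X.vert (p + 1) q ∘ₗ X.horiz p q + X.horiz p (q + 1) ∘ₗ X.vert p q = 0 := by
  rw [horiz, horiz, vert, vert]
  by_cases hp : Even p
  · rw [if_pos hp, if_pos hp, if_pos hp, if_neg (by simpa [Nat.even_add_one] using hp),
      I.one_sub_lam_comp_b, LinearMap.neg_comp, neg_add_cancel]
  · rw [if_neg hp, if_neg hp, if_neg hp, if_pos (by simpa [Nat.even_add_one] using hp),
      LinearMap.comp_neg, I.norm_comp_b', add_neg_cancel]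

end Identities

/-! ### Coordinates on the total complex, and `d ∘ d = 0`. -/

/-- The component in `X q` of an element of the total complex (`0` beyond the range). -/
noncomputable def coord {n : ℕ} (q : ℕ) : X.Tot n →ₗ[k] X.X q :=
  if h : q < n + 1 then LinearMap.proj (⟨q, h⟩ : Fin (n + 1)) else 0

theorem coord_of_lt {n : ℕ} (q : ℕ) (z : X.Tot n) (hq : n < q) : coord q z = 0 := by
  rw [coord, dif_neg (by omega)]; rfl

theorem coord_mk {n : ℕ} (f : (q : ℕ) → X.X q) (q : ℕ) (hq : q ≤ n) :
    coord q (fun i : Fin (n + 1) => f i : X.Tot n) = f q := by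
  rw [coord, dif_pos (by omega)]; rfl

theorem tot_ext {n : ℕ} {y z : X.Tot n} (h : ∀ q ≤ n, coord q y = coord q z) : y = z := by
  funext i
  have := h i (by omega)
  rw [coord, dif_pos i.2] at this
  exact this

theorem coord_zero_d (n : ℕ) (z : X.Tot n) : coord 0 (X.d n z) = X.horiz n 0 (coord 0 z) := by
  rw [coord, coord, dif_pos (by omega), dif_pos (by omega)]
  change (0 : X.X 0) + _ = _
  rw [zero_add]
  rfl

/-- For `j = n` the horizontal term is zero because `coord (n + 1) z` is, so the truncated
subtraction in its column index is harmless. -/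
theorem coord_succ_d (n j : ℕ) (hj : j ≤ n) (z : X.Tot n) :
    coord (j + 1) (X.d n z) = X.vert (n - j) j (coord j z)
      + X.horiz (n - (j + 1)) (j + 1) (coord (j + 1) z) := by
  rw [coord, coord, dif_pos (by omega), dif_pos (by omega)]
  change X.vert (n - j) j _ + (dite (j + 1 < n + 1) _ _ : X.Tot n →ₗ[k] X.X (j + 1)) z = _
  congr 1
  by_cases h : j + 1 < n + 1
  · rw [coord, dif_pos h, dif_pos h]; rfl
  · rw [coord, dif_neg h, dif_neg h]
    exact (map_zero _).symm

/-- Coordinate `q` of `d (d z)` collects a vertical-vertical term from `q - 2`, two mixed terms from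
`q - 1` and a horizontal-horizontal term from `q`; each group vanishes. The further cases are the
two edges: small `q`, where some groups are missing, and large `q`, where coordinates vanish and
column indices truncate. -/
theorem Identities.d_comp_d (I : X.Identities) (n : ℕ) : X.d (n + 1) ∘ₗ X.d n = 0 := by
  refine LinearMap.ext fun z => tot_ext fun q hq => ?_
  rw [LinearMap.comp_apply, LinearMap.zero_apply, map_zero]
  match q, hq with
  | 0, _ =>
    rw [coord_zero_d, coord_zero_d]
    exact LinearMap.congr_fun (I.horiz_comp_horiz n 0) _
  | 1, _ =>
    rw [coord_succ_d _ _ (by omega), coord_zero_d, coord_succ_d _ _ (by omega), map_add, ← add_assoc]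
    have h₁ := LinearMap.congr_fun (I.horiz_comp_vert n 0) (coord 0 z)
    refine (congrArg₂ (· + ·) h₁ ?_).trans (add_zero _)
    obtain _ | n := n
    · rw [coord_of_lt _ z (by omega), map_zero, map_zero]
    · exact LinearMap.congr_fun (I.horiz_comp_horiz n 1) _
  | j + 2, hj =>
    rw [coord_succ_d _ _ (by omega), coord_succ_d _ _ (by omega), map_add]
    have h₀ : X.vert (n + 1 - (j + 1)) (j + 1) (X.vert (n - j) j (coord j z)) = 0 := by
      rw [show n + 1 - (j + 1) = n - j by omega]
      exact LinearMap.congr_fun (I.vert_comp_vert (n - j) j) _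
    rw [h₀, zero_add]
    by_cases hn : j + 2 ≤ n + 1
    · rw [coord_succ_d _ _ (by omega), map_add, ← add_assoc]
      have h₁ : X.vert (n + 1 - (j + 1)) (j + 1) (X.horiz (n - (j + 1)) (j + 1) (coord (j + 1) z))
          + X.horiz (n + 1 - (j + 1 + 1)) (j + 1 + 1) (X.vert (n - (j + 1)) (j + 1)
            (coord (j + 1) z)) = 0 := by
        by_cases hj' : j + 1 ≤ n
        · rw [show n + 1 - (j + 1) = n - (j + 1) + 1 by omega,
            show n + 1 - (j + 1 + 1) = n - (j + 1) by omega]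
          exact LinearMap.congr_fun (I.horiz_comp_vert (n - (j + 1)) (j + 1)) _
        · rw [coord_of_lt _ z (by omega)]; simp
      rw [h₁, zero_add]
      by_cases hj' : j + 2 ≤ n
      · rw [show n + 1 - (j + 1 + 1) = n - (j + 1 + 1) + 1 by omega]
        exact LinearMap.congr_fun (I.horiz_comp_horiz (n - (j + 1 + 1)) (j + 2)) _
      · rw [coord_of_lt _ z (by omega), map_zero, map_zero]
    · rw [coord_of_lt _ z (by omega), coord_of_lt _ (X.d n z) (by omega)]; simp

/-! ### Cyclic cohomology from exactness of the columns. -/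

variable (X) in
/-- The columns `(X, b)` and `(X, b')` are exact, except that `b` vanishes in degree `0`. -/
structure ExactColumns : Prop where
  exact_b : ∀ n (x : X.X (n + 1)), X.b (n + 1) x = 0 → ∃ y, X.b n y = x
  exact_b' : ∀ n (x : X.X (n + 1)), X.b' (n + 1) x = 0 → ∃ y, X.b' n y = x
  b_zero : X.b 0 = 0
  b'_zero : ∀ x : X.X 0, X.b' 0 x = 0 → x = 0

namespace ExactColumns

variable (E : X.ExactColumns)
include E

theorem exact_vert (p q : ℕ) (x : X.X (q + 1)) (hx : X.vert p (q + 1) x = 0) :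
    ∃ y, X.vert p q y = x := by
  rw [vert] at hx ⊢
  split_ifs at hx ⊢ with hp
  · exact E.exact_b q x hx
  · rw [LinearMap.neg_apply, neg_eq_zero] at hx
    obtain ⟨y, hy⟩ := E.exact_b' q x hx
    exact ⟨-y, by rw [map_neg, LinearMap.neg_apply, neg_neg, hy]⟩

theorem eq_zero_of_vert {p : ℕ} (hp : ¬ Even p) (x : X.X 0) (hx : X.vert p 0 x = 0) : x = 0 := by
  rw [vert, if_neg hp, LinearMap.neg_apply, neg_eq_zero] at hx
  exact E.b'_zero x hx

/-- If `d w` is concentrated in `C^{*,0}`, then `w` is so up to a coboundary. -/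
theorem exists_boundary (I : X.Identities) (N : ℕ) (w : X.Tot N)
    (hw : ∀ q, coord (q + 1) (X.d N w) = 0) :
    ∃ y ∈ X.boundaries N, ∀ q, coord (q + 1) (w - y) = 0 := by
  -- The coordinates of `w` are cleared from the highest row downwards.
  suffices H : ∀ m, ∃ y ∈ X.boundaries N, ∀ q, N - m < q → coord q (w - y) = 0 by
    obtain ⟨y, hy, h⟩ := H N
    exact ⟨y, hy, fun q => h _ (by omega)⟩
  intro m
  induction m with
  | zero => exact ⟨0, zero_mem _, fun q hq => coord_of_lt _ _ (by omega)⟩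
  | succ m ih =>
    obtain ⟨y, hy, h⟩ := ih
    obtain h0 | ⟨r, hr⟩ : N - m = 0 ∨ ∃ r, N - m = r + 1 := by
      cases N - m <;> simp
    · exact ⟨y, hy, fun q hq => h q (by omega)⟩
    obtain ⟨M, rfl⟩ : ∃ M, N = M + 1 := ⟨N - 1, by omega⟩
    obtain ⟨a, rfl⟩ := hy
    have hd : X.d (M + 1) (X.d M a) = 0 := LinearMap.congr_fun (I.d_comp_d M) a
    have h₁ := coord_succ_d (M + 1) (r + 1) (by omega) (w - X.d M a)
    -- The row above is already cleared, so the top surviving coordinate is a vertical cocycle,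
    -- hence vertically exact.
    rw [map_sub (X.d (M + 1)), hd, sub_zero, hw, h (r + 1 + 1) (by omega), map_zero, add_zero] at h₁
    obtain ⟨u, hu⟩ := E.exact_vert _ _ _ h₁.symm
    -- Placed in row `r` alone, `u` has a total coboundary that cancels the coordinate in row `r +
    -- 1` and leaves the higher rows at zero; its horizontal part only affects row `r`.
    let f : (q : ℕ) → X.X q := Function.update (fun _ => 0) r u
    let c : X.Tot M := fun i => f i
    have hc : coord r c = u := (coord_mk f r (by omega)).trans (Function.update_self _ _ _)
    have hc' : ∀ q, r < q → coord q c = 0 := by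
      intro q hq
      by_cases hqM : q ≤ M
      · exact (coord_mk f q hqM).trans (Function.update_of_ne (by omega) _ _)
      · exact coord_of_lt _ _ (by omega)
    refine ⟨X.d M a + X.d M c, add_mem ⟨a, rfl⟩ ⟨c, rfl⟩, fun q hq => ?_⟩
    obtain ⟨q, rfl⟩ : ∃ q', q = q' + 1 := ⟨q - 1, by omega⟩
    rw [← sub_sub, map_sub]
    by_cases hqM : q ≤ M
    · rw [coord_succ_d M q hqM c, hc' (q + 1) (by omega), map_zero, add_zero]
      by_cases hqr : q = r
      · subst hqr
        rw [hc, ← hu, show M + 1 - (q + 1) = M - q by omega, sub_self]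
      · rw [hc' q (by omega), map_zero, sub_zero, h (q + 1) (by omega)]
    · rw [coord_of_lt _ _ (by omega), coord_of_lt _ _ (by omega), sub_zero]

/-- The element lies in an odd column, where row `1` of `d w` is `-b'` of it and `b'` is injective
on `X 0`. Nothing is asked of row `0` of `d w`, so that the lemma also applies to primitives of
elements of the bottom row. -/
theorem eq_zero_of_odd {N : ℕ} (hN : ¬ Even N) (w : X.Tot N) (h : ∀ q, coord (q + 1) w = 0)
    (hw : ∀ q, coord (q + 1) (X.d N w) = 0) : w = 0 := by
  refine tot_ext fun q _ => ?_
  rw [map_zero]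
  match q with
  | q + 1 => exact h q
  | 0 =>
    have := hw 0
    rw [coord_succ_d N 0 (by omega), h, map_zero, add_zero] at this
    exact E.eq_zero_of_vert hN _ this

theorem subsingleton_HC (I : X.Identities) {N : ℕ} (hN : ¬ Even N) : Subsingleton (X.HC N) := by
  refine Submodule.Quotient.subsingleton_iff.2 (eq_top_iff.2 fun z _ => ?_)
  obtain ⟨w, hw⟩ := z
  rw [LinearMap.mem_ker] at hw
  obtain ⟨y, hy, h⟩ := E.exists_boundary I N w (fun q => by rw [hw, map_zero])
  have hdy : X.d N y = 0 := by
    match N, y, hy with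
    | 0, y, hy => rw [show y = 0 from hy, map_zero]
    | N + 1, _, ⟨a, rfl⟩ => exact LinearMap.congr_fun (I.d_comp_d N) a
  have h0 := E.eq_zero_of_odd hN (w - y) h (fun q => by rw [map_sub (X.d N), hw, hdy, sub_zero, map_zero])
  change w ∈ X.boundaries N
  rwa [sub_eq_zero.1 h0]

/-- The inclusion of `X 0 = C^{n,0}` into the total complex. -/
noncomputable def bottom (X : CocyclicData.{w, h} k) (n : ℕ) : X.X 0 →ₗ[k] X.Tot n :=
  LinearMap.single k (fun q : Fin (n + 1) => X.X q) 0

omit E in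
theorem coord_zero_bottom (n : ℕ) (x : X.X 0) : coord 0 (bottom X n x) = x := by
  rw [coord, dif_pos (by omega)]
  exact Pi.single_eq_same (M := fun q : Fin (n + 1) => X.X q) 0 x

omit E in
theorem coord_succ_bottom (n q : ℕ) (x : X.X 0) : coord (q + 1) (bottom X n x) = 0 := by
  rw [coord]
  split_ifs with hq
  · exact Pi.single_eq_of_ne (M := fun q : Fin (n + 1) => X.X q) (i := 0) (i' := ⟨q + 1, hq⟩)
      (by simp [Fin.ext_iff]) x
  · rfl

/-- In an even column both differentials leaving `X 0` vanish: `1 - λ` as `τ₀ = id`, and `b` by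
`b_zero`. -/
theorem d_bottom (hτ : X.τ 0 = LinearMap.id) {N : ℕ} (hN : Even N) (x : X.X 0) :
    X.d N (bottom X N x) = 0 := by
  refine tot_ext fun q hq => ?_
  rw [map_zero]
  match q with
  | 0 =>
    rw [coord_zero_d, coord_zero_bottom, horiz, if_pos hN, lam, hτ, pow_zero, one_smul]
    exact sub_self _
  | 1 =>
    rw [coord_succ_d N 0 (by omega), coord_zero_bottom, coord_succ_bottom, map_zero, add_zero,
      vert, Nat.sub_zero, if_pos hN, E.b_zero]
    rfl
  | q + 2 =>
    rw [coord_succ_d N _ (by omega), coord_succ_bottom, coord_succ_bottom, map_zero, map_zero,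
      add_zero]

theorem nonempty_HC_equiv (I : X.Identities) (hτ : X.τ 0 = LinearMap.id) {N : ℕ} (hN : Even N) :
    Nonempty (X.HC N ≃ₗ[k] X.X 0) := by
  let f : X.X 0 →ₗ[k] X.HC N := (Submodule.mkQ _).comp
    ((bottom X N).codRestrict (LinearMap.ker (X.d N)) fun x => E.d_bottom hτ hN x)
  refine ⟨(LinearEquiv.ofBijective f ⟨?_, ?_⟩).symm⟩
  · refine (injective_iff_map_eq_zero f).2 fun x hx => ?_
    have hx' : bottom X N x ∈ X.boundaries N := by
      have := (Submodule.Quotient.mk_eq_zero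
        ((X.boundaries N).comap (LinearMap.ker (X.d N)).subtype)).1 hx
      exact this
    suffices bottom X N x = 0 by rw [← coord_zero_bottom N x, this, map_zero]
    match N, hN, hx' with
    | 0, _, hx' => exact hx'
    | N + 1, hN, ⟨a, ha⟩ =>
      have ha' : ∀ q, coord (q + 1) (X.d N a) = 0 := fun q => by rw [ha, coord_succ_bottom]
      -- The primitive `a` has odd degree, so the descent makes it equal to a coboundary `y`; hence
      -- `d a = 0`.
      obtain ⟨y, hy, h⟩ := E.exists_boundary I N a ha'
      have hdy : X.d N y = 0 := by
        match N, y, hy with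
        | 0, y, hy => rw [show y = 0 from hy, map_zero]
        | N + 1, _, ⟨a, rfl⟩ => exact LinearMap.congr_fun (I.d_comp_d N) a
      have h0 := E.eq_zero_of_odd (by simpa [Nat.even_add_one] using hN) (a - y) h (fun q => by
        rw [map_sub (X.d N), hdy, sub_zero, ha'])
      rw [← ha, sub_eq_zero.1 h0, hdy]
  · intro z
    obtain ⟨⟨w, hw⟩, rfl⟩ := Submodule.Quotient.mk_surjective _ z
    have hw' := LinearMap.mem_ker.1 hw
    obtain ⟨y, hy, h⟩ := E.exists_boundary I N w (fun q => by rw [hw', map_zero])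
    -- After the descent only row `0` of the cocycle is left, and this is the preimage.
    refine ⟨coord 0 (w - y), (Submodule.Quotient.eq _).2 ?_⟩
    change bottom X N (coord 0 (w - y)) - w ∈ X.boundaries N
    have : bottom X N (coord 0 (w - y)) = w - y := by
      refine tot_ext fun q _ => ?_
      match q with
      | 0 => rw [coord_zero_bottom]
      | q + 1 => rw [coord_succ_bottom, h]
    rw [this, sub_sub_cancel_left]
    exact neg_mem hy

end ExactColumns

end CocyclicData

/-! ### Morphisms with a fixed target and their quotients `b⁻¹a`. -/

/-- The morphisms with target `X`. -/
abbrev Into {G : Type u} [Groupoid.{v} G] (X : G) : Type (max u v) := Σ Y : G, (Y ⟶ X)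

namespace Into

variable {G : Type u} [Groupoid.{v} G] {X Y Z : G}

/-- The underlying morphism. -/
def mor (a : Into X) : Mor G := ⟨a.2⟩

/-- The identity of `X`. -/
def id (X : G) : Into X := ⟨X, 𝟙 X⟩

/-- The composite `g ∘ a`. -/
def push (g : X ⟶ Y) (a : Into X) : Into Y := ⟨a.1, a.2 ≫ g⟩

/-- The composite `b⁻¹ ∘ a`. -/
def div (b a : Into X) : Into b.1 := push (Groupoid.inv b.2) a

theorem div_self (a : Into X) : div a a = id a.1 := by
  simp [div, push, id]

theorem id_div (a : Into X) : div (id X) a = a := by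
  simp [div, push, id]

/-- The cancellation `(a⁻¹b)⁻¹(a⁻¹c) = b⁻¹c` changes the base point of homogeneous coordinates;
`tau_elt` and `del_elt` depend on it. -/
theorem push_div (a b c : Into X) : push (Groupoid.inv (div a b).2) (div a c) = div b c := by
  simp [div, push]

theorem push_id (a b : Into X) : push (Groupoid.inv (div a b).2) (id a.1) = div b a := by
  simp [div, push, id]

theorem div_injective (a : Into X) {b c : Into X} (h : div a b = div a c) : b = c := by
  obtain ⟨Y, b⟩ := b
  obtain ⟨Z, c⟩ := c
  simp only [div, push, Sigma.mk.injEq] at h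
  obtain ⟨rfl, h⟩ := h
  simpa using h

theorem mor_injective : Function.Injective (mor : Into X → Mor G) := by
  rintro ⟨Y, a⟩ ⟨Z, b⟩ h
  simp only [mor, Mor.mk.injEq] at h
  obtain ⟨rfl, -, h⟩ := h
  rw [eq_of_heq h]

end Into

/-! ### Tensors of morphisms with a common target, and the structure maps on them. -/

noncomputable section

namespace GroupoidAlgebra

variable {k : Type w} {G : Type u} [CommRing k] [Groupoid.{v} G] [Fintype G]

theorem of_mul_mor {X Y : G} (g : X ⟶ Y) (a : Into X) :
    (of ⟨g⟩ * of a.mor : GroupoidAlgebra k G) = of (Into.push g a).mor := by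
  rw [of_mul_of]
  exact (mulBasis_pos (show (Mor.mk g).src = a.mor.tgt from rfl)).trans
    (congrArg of (Mor.comp_mk a.2 g rfl))

theorem one_mul_mor {X : G} (a : Into X) :
    (of (Mor.one X) * of a.mor : GroupoidAlgebra k G) = of a.mor := one_mul_of a.mor

variable (k) in
/-- The tensor `y₀ ⊗ ⋯ ⊗ y_n` of morphisms with the same target. -/
def pure {X : G} : (n : ℕ) → (ℕ → Into X) → (paraHopf k G).pow n
  | 0, y => (of (y 0).mor : GroupoidAlgebra k G)
  | n + 1, y => (paraHopf k G).tmul ((paraHopf k G).pow n) (of (y 0).mor) (pure n fun m => y (m + 1))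

theorem pure_congr {X : G} (n : ℕ) {y z : ℕ → Into X} (h : ∀ m ≤ n, y m = z m) :
    pure k n y = pure k n z := by
  induction n generalizing y z with
  | zero => rw [pure, pure, h 0 le_rfl]
  | succ n ih => rw [pure, pure, h 0 (by omega), ih fun m hm => h (m + 1) (by omega)]

theorem act_pure {X : G} (n : ℕ) (y : ℕ → Into X) :
    ((paraHopf k G).pow n).act (of (unitOne X)) (pure k n y) = pure k n y := by
  cases n with
  | zero =>
    change (incl (of (unitOne X)) * of (y 0).mor : GroupoidAlgebra k G) = of (y 0).mor
    rw [incl_of, one_mul_mor]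
  | succ n =>
    change (paraHopf k G).tmul ((paraHopf k G).pow n)
      (incl (of (unitOne X)) * of (y 0).mor : GroupoidAlgebra k G) _ = _
    rw [incl_of, one_mul_mor]; rfl

theorem act_pure_ne {X Y : G} (hXY : Y ≠ X) (n : ℕ) (y : ℕ → Into X) :
    ((paraHopf k G).pow n).act (of (unitOne Y)) (pure k n y) = 0 := by
  cases n with
  | zero =>
    change (incl (of (unitOne Y)) * of (y 0).mor : GroupoidAlgebra k G) = 0
    rw [incl_of, one_mul_of_ne Y (y 0).mor hXY]
  | succ n =>
    change (paraHopf k G).tmul ((paraHopf k G).pow n)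
      (incl (of (unitOne Y)) * of (y 0).mor : GroupoidAlgebra k G) _ = 0
    rw [incl_of, one_mul_of_ne Y (y 0).mor hXY, map_zero, LinearMap.zero_apply]

/-- Since `a = id_X · a`, the idempotent `id_X` can be moved across `⊗_R`. This forces factors to
share their target. -/
theorem tmul_eq_tmul_act {X : G} (n : ℕ) (a : Into X) (z : (paraHopf k G).pow n) :
    (paraHopf k G).tmul ((paraHopf k G).pow n) (of a.mor) z
      = (paraHopf k G).tmul ((paraHopf k G).pow n) (of a.mor)
        (((paraHopf k G).pow n).act (of (unitOne X)) z) := by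
  rw [← BaseData.tmul_tgt]
  refine congrArg (fun t => (paraHopf k G).tmul ((paraHopf k G).pow n) t z) ?_
  change of a.mor = (incl (of (unitOne X)) * of a.mor : GroupoidAlgebra k G)
  rw [incl_of, one_mul_mor]

theorem tens_pow_hom_ext {N : Type*} [AddCommGroup N] [Module k N] (n : ℕ)
    {f g : (paraHopf k G).Tens ((paraHopf k G).pow n) →ₗ[k] N}
    (h : ∀ a : Mor G, f.comp ((paraHopf k G).tmul ((paraHopf k G).pow n) (of a))
      = g.comp ((paraHopf k G).tmul ((paraHopf k G).pow n) (of a))) : f = g := by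
  refine (paraHopf k G).hom_ext fun x m => ?_
  induction x using ind with
  | h0 => simp
  | hadd x y hx hy => rw [map_add, LinearMap.add_apply, map_add, map_add, hx, hy]
  | hsmul c x hx => rw [map_smul, LinearMap.smul_apply, map_smul, map_smul, hx]
  | hof a => exact LinearMap.congr_fun (h a) m

/-- Tensors of morphisms span, and those with two different targets are zero, because orthogonal
idempotents meet across `⊗_R`. -/
theorem pow_hom_ext {N : Type*} [AddCommGroup N] [Module k N] (n : ℕ)
    {f g : (paraHopf k G).pow n →ₗ[k] N}
    (h : ∀ (X : G) (y : ℕ → Into X), f (pure k n y) = g (pure k n y)) : f = g := by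
  induction n with
  | zero => exact hom_ext fun a => h a.tgt fun _ => ⟨a.src, a.hom⟩
  | succ n ih =>
    refine tens_pow_hom_ext n fun a => ih fun X y => ?_
    by_cases hX : X = a.tgt
    · subst hX
      exact h a.tgt fun m => Nat.casesOn m ⟨a.src, a.hom⟩ y
    · have : (paraHopf k G).tmul ((paraHopf k G).pow n) (of a) (pure k n y) = 0 := by
        refine (tmul_eq_tmul_act n (⟨a.src, a.hom⟩ : Into a.tgt) (pure k n y)).trans ?_
        rw [act_pure_ne (fun e => hX e.symm), map_zero]
      exact (congrArg f this).trans ((map_zero f).trans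
        ((map_zero g).symm.trans (congrArg g this.symm)))

/-- The sequence `a, y₀, y₁, …`. -/
def cons {α : Type*} (a : α) (y : ℕ → α) : ℕ → α
  | 0 => a
  | m + 1 => y m

/-- The sequence with the `j`-th term doubled. -/
def dup {α : Type*} (j : ℕ) (y : ℕ → α) : ℕ → α := fun m => if m ≤ j then y m else y (m - 1)

/-- The sequence with `a` in the place of the terms after the `n`-th. -/
def snoc {α : Type*} (n : ℕ) (a : α) (y : ℕ → α) : ℕ → α := fun m => if m ≤ n then y m else a

theorem tmul_one_pure {X : G} (n : ℕ) (y : ℕ → Into X) :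
    (paraHopf k G).tmul ((paraHopf k G).pow n) 1 (pure k n y)
      = pure k (n + 1) (cons (Into.id X) y) := by
  conv_lhs => rw [← act_pure n y]
  rw [← BaseData.tmul_tgt]
  refine congrArg (fun t => (paraHopf k G).tmul ((paraHopf k G).pow n) t (pure k n y)) ?_
  exact (mul_one _).trans (incl_of X)

/-- Morphisms are group-like for `Δ`, so the diagonal action composes every factor with `g`. -/
theorem diagAct_pure {X Y : G} (g : X ⟶ Y) (n : ℕ) (y : ℕ → Into X) :
    ((paraHopf k G).diagAct n).map (of ⟨g⟩) (pure k n y) = pure k n fun m => (y m).push g := by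
  induction n generalizing y with
  | zero => exact of_mul_mor g (y 0)
  | succ n ih =>
    change ((paraHopf k G).diagAct n).pair (comulMap (of ⟨g⟩)) (of (y 0).mor)
      (pure k n fun m => y (m + 1)) = _
    rw [comulMap_of]
    refine (Bialgebroid.HAct.pair_tmul ((paraHopf k G).diagAct n) (of ⟨g⟩) (of ⟨g⟩)
      (of (y 0).mor) (pure k n fun m => y (m + 1))).trans ?_
    rw [ih, of_mul_mor]
    rfl

theorem append_pure {X : G} (n : ℕ) (y : ℕ → Into X) :
    ((paraHopf k G).append n).map (pure k n y) = pure k (n + 1) (snoc n (Into.id X) y) := by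
  induction n generalizing y with
  | zero =>
    refine (tmul_eq_tmul_act 0 (y 0) (1 : GroupoidAlgebra k G)).trans ?_
    refine congrArg ((paraHopf k G).tmul ((paraHopf k G).pow 0) (of (y 0).mor)) ?_
    exact (mul_one _).trans (incl_of X)
  | succ n ih =>
    change (paraHopf k G).tmul ((paraHopf k G).pow (n + 1)) (of (y 0).mor)
      (((paraHopf k G).append n).map (pure k n fun m => y (m + 1))) = _
    rw [ih]
    change pure k (n + 2) (cons (y 0) (snoc n (Into.id X) fun m => y (m + 1))) = _
    refine pure_congr _ fun m _ => ?_
    cases m <;> simp [cons, snoc]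

theorem insert_eq_append (n : ℕ) :
    (paraHopf k G).insert n (n + 1) = (paraHopf k G).append n := by
  induction n with
  | zero => rfl
  | succ n ih => exact congrArg (paraHopf k G).idTens ih

theorem insert_pure {X : G} (n j : ℕ) (hj : j ≤ n) (y : ℕ → Into X) :
    ((paraHopf k G).insert n j).map (pure k n y) = pure k (n + 1) (dup j y) := by
  induction n generalizing j y with
  | zero =>
    obtain rfl : j = 0 := by omega
    exact comulMap_of _
  | succ n ih =>
    cases j with
    | zero =>
      change (coringData k G).assoc ((paraHopf k G).pow n) (comulMap (of (y 0).mor))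
        (pure k n fun m => y (m + 1)) = _
      rw [comulMap_of]
      change pure k (n + 2) (cons (y 0) y) = _
      refine pure_congr _ fun m _ => ?_
      cases m <;> simp [cons, dup]
    | succ j =>
      change (paraHopf k G).tmul ((paraHopf k G).pow (n + 1)) (of (y 0).mor)
        (((paraHopf k G).insert n j).map (pure k n fun m => y (m + 1))) = _
      rw [ih j (by omega)]
      change pure k (n + 2) (cons (y 0) (dup j fun m => y (m + 1))) = _
      refine pure_congr _ fun m _ => ?_
      cases m with
      | zero => simp [cons, dup]
      | succ m =>
        simp only [cons, dup, Nat.add_le_add_iff_right, Nat.add_sub_cancel]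
        split_ifs with h
        · rfl
        · rw [Nat.sub_add_cancel (by omega)]

theorem antipode_mor {X : G} (a : Into X) :
    (paraHopf k G).antipode (of a.mor) = (of ⟨Groupoid.inv a.2⟩ : GroupoidAlgebra k G) :=
  invMap_of a.mor

theorem cyc_pure {X : G} (n : ℕ) (y : ℕ → Into X) :
    (paraHopf k G).cyc n (pure k n y) = pure k n fun m =>
      (if m < n then y (m + 1) else Into.id X).push (Groupoid.inv (y 0).2) := by
  cases n with
  | zero =>
    refine (antipode_mor (y 0)).trans ?_
    simp [pure, Into.push, Into.id, Into.mor]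
  | succ n =>
    change ((paraHopf k G).diagAct (n + 1)).map ((paraHopf k G).antipode (of (y 0).mor))
      (((paraHopf k G).append n).map (pure k n fun m => y (m + 1))) = _
    rw [antipode_mor, append_pure, diagAct_pure]
    refine pure_congr _ fun m _ => ?_
    simp [snoc]

end GroupoidAlgebra

end

/-! ### Contracting homotopies for `b` and `b'`. -/

namespace CocyclicData

variable {k : Type w} [CommRing k] {X : CocyclicData.{w, h} k}

/-- The term `δ₀` contributes the identity, and the index shift in the others turns the alternating
sum into `-b' s`. Only the cofaces occurring in `b'` are involved, so the last one is not
constrained. -/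
theorem contraction_comp_b' {n : ℕ} (s : X.X (n + 1) →ₗ[k] X.X n)
    (s' : X.X (n + 2) →ₗ[k] X.X (n + 1)) (h₀ : s' ∘ₗ X.cof (n + 1) 0 = LinearMap.id)
    (hs : ∀ i ≤ n, s' ∘ₗ X.cof (n + 1) (i + 1) = X.cof n i ∘ₗ s) (x : X.X (n + 1)) :
    s' (X.b' (n + 1) x) = x - X.b' n (s x) := by
  have : s' ∘ₗ X.b' (n + 1) = LinearMap.id - X.b' n ∘ₗ s := by
    rw [b'_eq_sum, b'_eq_sum, comp_sum, sum_comp, Finset.sum_range_succ', sub_eq_neg_add,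
      ← Finset.sum_neg_distrib]
    congr 1
    · refine Finset.sum_congr rfl fun i hi => ?_
      rw [LinearMap.comp_smul, hs i (by have := Finset.mem_range.1 hi; omega), LinearMap.smul_comp,
        pow_succ, mul_neg_one, neg_smul]
    · rw [pow_zero, one_smul, h₀]
  exact LinearMap.congr_fun this x

theorem contraction_comp_b {n : ℕ} (s : X.X (n + 1) →ₗ[k] X.X n)
    (s' : X.X (n + 2) →ₗ[k] X.X (n + 1)) (h₀ : s' ∘ₗ X.cof (n + 1) 0 = LinearMap.id)
    (hs : ∀ i ≤ n + 1, s' ∘ₗ X.cof (n + 1) (i + 1) = X.cof n i ∘ₗ s) (x : X.X (n + 1)) :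
    s' (X.b (n + 1) x) = x - X.b n (s x) := by
  have : s' ∘ₗ X.b (n + 1) = LinearMap.id - X.b n ∘ₗ s := by
    rw [b_eq_sum, b_eq_sum, comp_sum, sum_comp, Finset.sum_range_succ', sub_eq_neg_add,
      ← Finset.sum_neg_distrib]
    congr 1
    · refine Finset.sum_congr rfl fun i hi => ?_
      rw [LinearMap.comp_smul, hs i (by have := Finset.mem_range.1 hi; omega), LinearMap.smul_comp,
        pow_succ, mul_neg_one, neg_smul]
    · rw [pow_zero, one_smul, h₀]
  exact LinearMap.congr_fun this x

end CocyclicData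

/-! ### Homogeneous coordinates on `H_♮` and the cocyclic identities. -/

noncomputable section

namespace GroupoidAlgebra

variable {k : Type w} {G : Type u} [CommRing k] [Groupoid.{v} G] [Fintype G]

variable (k) in
/-- The element `x₀⁻¹x₁ ⊗ ⋯ ⊗ x₀⁻¹x_n` with homogeneous coordinates `x₀, …, x_n`. -/
def elt {X : G} : (n : ℕ) → (ℕ → Into X) → (paraHopf k G).natural.X n
  | 0, x => (of (unitOne (x 0).1) : Base k G)
  | n + 1, x => pure k n fun m => (x 0).div (x (m + 1))

theorem elt_congr {X : G} (n : ℕ) {x y : ℕ → Into X} (h : ∀ m ≤ n, x m = y m) :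
    elt k n x = elt k n y := by
  cases n with
  | zero =>
    change (of (unitOne (x 0).1) : Base k G) = of (unitOne (y 0).1)
    rw [h 0 le_rfl]
  | succ n =>
    have key : ∀ a b : Into X, a = b → pure k n (fun m => a.div (x (m + 1)))
        = pure k n (fun m => a.div (y (m + 1))) := fun a _ _ =>
      pure_congr n fun m hm => by rw [h (m + 1) (by omega)]
    -- The base point is changed separately, since the type of `a.div _` depends on `a`.
    have key' : ∀ a b : Into X, a = b → (pure k n (fun m => a.div (y (m + 1))))
        = pure k n (fun m => b.div (y (m + 1))) := fun a b e => by subst e; rfl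
    exact (key (x 0) _ rfl).trans (key' _ _ (h 0 (by omega)))

theorem elt_cons {X : G} (n : ℕ) (a : Into X) (y : ℕ → Into X) :
    elt k (n + 1) (cons a y) = pure k n fun m => a.div (y m) := rfl

/-- Every tensor of morphisms with target `X` has homogeneous coordinates with `x₀ = id_X`. -/
theorem natural_hom_ext {N : Type*} [AddCommGroup N] [Module k N] (n : ℕ)
    {f g : (paraHopf k G).natural.X n →ₗ[k] N}
    (h : ∀ (X : G) (x : ℕ → Into X), f (elt k n x) = g (elt k n x)) : f = g := by
  cases n with
  | zero =>
    refine hom_ext (k := k) (G := Units G) fun s => ?_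
    rw [eq_unitOne s]
    exact h s.src.obj fun _ => Into.id _
  | succ n =>
    refine pow_hom_ext n fun X y => ?_
    have := h X (cons (Into.id X) y)
    simp only [elt_cons, Into.id_div] at this
    exact this

/-- The homogeneous coordinates of a coface. -/
def cofSeq {α : Type*} (n i : ℕ) (x : ℕ → α) : ℕ → α :=
  if i ≤ n then dup i x else snoc n (x 0) x

theorem cofSeq_apply {α : Type*} (n i m : ℕ) (x : ℕ → α) :
    cofSeq n i x m = if i ≤ n then (if m ≤ i then x m else x (m - 1))
      else if m ≤ n then x m else x 0 := by
  rw [cofSeq]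
  split_ifs <;> simp_all [dup, snoc]

/-- The outer cofaces insert a `1`, which over `R` becomes the identity `x₀⁻¹x₀`: in front this
doubles `x₀`, at the end it appends `x₀`. The inner cofaces repeat the factor `x₀⁻¹x_i`. -/
theorem cof_elt {X : G} (n i : ℕ) (hi : i ≤ n + 1) (x : ℕ → Into X) :
    (paraHopf k G).natural.cof n i (elt k n x) = elt k (n + 1) (cofSeq n i x) := by
  rw [CocyclicData.cof, dif_pos (by omega)]
  cases n with
  | zero =>
    have h₁ : elt k 1 (cofSeq 0 i x) = (of (Into.id (x 0).1).mor : GroupoidAlgebra k G) := by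
      refine (elt_congr 1 (y := cons (x 0) fun _ => x 0) fun m hm => ?_).trans ?_
      · rw [cofSeq_apply]
        obtain rfl | rfl : m = 0 ∨ m = 1 := by omega
        all_goals split_ifs <;> first | rfl | omega
      · rw [← Into.div_self]; rfl
    rw [h₁]
    obtain rfl | rfl : i = 0 ∨ i = 1 := by omega
    · exact incl_of _
    · exact incl_of _
  | succ n =>
    cases i with
    | zero =>
      refine (tmul_one_pure n _).trans ?_
      refine Eq.trans ?_ (elt_congr (n + 2) (x := cons (x 0) x) fun m hm => ?_)
      · rw [elt_cons]
        refine pure_congr _ fun m _ => ?_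
        cases m
        · exact (Into.div_self _).symm
        · rfl
      · cases m <;> simp [cofSeq, dup, cons]
    | succ j =>
      by_cases hj : j ≤ n
      · refine (insert_pure n j hj _).trans ?_
        refine Eq.trans ?_ (elt_congr (n + 2) (x := cons (x 0) fun m => dup (j + 1) x (m + 1))
          fun m hm => ?_)
        · rw [elt_cons]
          refine pure_congr _ fun m _ => ?_
          simp only [dup, Nat.add_le_add_iff_right, Nat.add_sub_cancel]
          split_ifs with h
          · rfl
          · rw [Nat.sub_add_cancel (by omega)]
        · rw [cofSeq, if_pos (by omega)]
          cases m <;> simp [dup, cons]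
      · obtain rfl : j = n + 1 := by omega
        refine (congrArg (fun f : LMod.Hom _ _ => f.map (elt k (n + 1) x))
          (insert_eq_append n)).trans ?_
        refine (append_pure n _).trans ?_
        refine Eq.trans ?_ (elt_congr (n + 2)
          (x := cons (x 0) fun m => snoc (n + 1) (x 0) x (m + 1)) fun m hm => ?_)
        · rw [elt_cons]
          refine pure_congr _ fun m _ => ?_
          simp only [snoc, Nat.add_le_add_iff_right]
          split_ifs with h
          · rfl
          · exact (Into.div_self _).symm
        · rw [cofSeq, if_neg (by omega)]
          cases m <;> simp [snoc, cons]

/-- Rotation of the first `n + 1` terms. -/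
def rot {α : Type*} (n : ℕ) (x : ℕ → α) : ℕ → α := fun m => if m < n then x (m + 1) else x 0

/-- The antipode gives `T(x₀⁻¹x₁) = x₁⁻¹x₀`. Acting diagonally, it turns each remaining `x₀⁻¹x_m`
into `x₁⁻¹x_m` and the appended identity into `x₁⁻¹x₀`, so that `x₁` becomes the base point and `x₀`
goes to the end. -/
theorem tau_elt {X : G} (n : ℕ) (x : ℕ → Into X) :
    (paraHopf k G).natural.τ n (elt k n x) = elt k n (rot n x) := by
  cases n with
  | zero => rfl
  | succ n =>
    refine (cyc_pure n _).trans ?_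
    refine Eq.trans ?_ (elt_congr (n + 1)
      (x := cons (x 1) fun m => rot (n + 1) x (m + 1)) fun m hm => ?_)
    · rw [elt_cons]
      refine pure_congr _ fun m _ => ?_
      simp only [rot, Nat.add_lt_add_iff_right]
      split_ifs with h
      · exact Into.push_div _ _ _
      · exact Into.push_id _ _
    · cases m <;> simp [rot, cons]

theorem tau_pow_elt {X : G} (n j : ℕ) (hj : j ≤ n + 1) (x : ℕ → Into X) :
    ((paraHopf k G).natural.τ n ^ j) (elt k n x)
      = elt k n fun m => if m + j ≤ n then x (m + j) else x (m + j - (n + 1)) := by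
  induction j with
  | zero => exact elt_congr n fun m hm => by simp [hm]
  | succ j ih =>
    rw [pow_succ', Module.End.mul_apply, ih (by omega), tau_elt]
    refine elt_congr n fun m hm => ?_
    simp only [rot]
    split_ifs <;> first | omega | (congr 1; omega)

theorem cofSeq_cofSeq {α : Type*} (n i j m : ℕ) (hij : i ≤ j) (hj : j ≤ n + 1) (x : ℕ → α) :
    cofSeq (n + 1) (j + 1) (cofSeq n i x) m = cofSeq (n + 1) i (cofSeq n j x) m := by
  simp only [cofSeq_apply]
  split_ifs <;> first | rfl | omega

theorem rot_cofSeq_succ {α : Type*} (n i m : ℕ) (hi : i ≤ n) (hm : m ≤ n + 1) (x : ℕ → α) :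
    rot (n + 1) (cofSeq n (i + 1) x) m = cofSeq n i (rot n x) m := by
  simp only [cofSeq_apply, rot]
  split_ifs <;> first | rfl | omega | (congr 1; omega)

theorem rot_cofSeq_zero {α : Type*} (n m : ℕ) (hm : m ≤ n + 1) (x : ℕ → α) :
    rot (n + 1) (cofSeq n 0 x) m = cofSeq n (n + 1) x m := by
  simp only [cofSeq_apply, rot]
  split_ifs <;> first | rfl | omega

theorem natural_identities : (paraHopf k G).natural.Identities where
  cof_cof n i j hij hj := natural_hom_ext n fun X x => by
    rw [LinearMap.comp_apply, LinearMap.comp_apply, cof_elt _ _ (by omega), cof_elt _ _ (by omega),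
      cof_elt _ _ (by omega), cof_elt _ _ (by omega)]
    exact elt_congr _ fun m _ => cofSeq_cofSeq n i j m hij hj x
  tau_cof_succ n i hi := natural_hom_ext n fun X x => by
    rw [LinearMap.comp_apply, LinearMap.comp_apply, cof_elt _ _ (by omega), tau_elt, tau_elt,
      cof_elt _ _ (by omega)]
    exact elt_congr _ fun m hm => rot_cofSeq_succ n i m hi hm x
  tau_cof_zero n := natural_hom_ext n fun X x => by
    rw [LinearMap.comp_apply, cof_elt _ _ (by omega), tau_elt, cof_elt _ _ (by omega)]
    exact elt_congr _ fun m hm => rot_cofSeq_zero n m hm x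
  tau_pow n := natural_hom_ext n fun X x => by
    rw [tau_pow_elt n _ le_rfl]
    exact elt_congr _ fun m hm => by simp [show ¬ m + (n + 1) ≤ n by omega]

/-! ### The contraction of the `b'` columns. -/

variable (k G) in
/-- The contraction deleting `x₀`. -/
def del : (n : ℕ) → (paraHopf k G).natural.X (n + 1) →ₗ[k] (paraHopf k G).natural.X n
  | 0 => counitMap.comp invMap
  | n + 1 => (paraHopf k G).lift (M := (paraHopf k G).pow n)
      (((paraHopf k G).diagAct n).map.comp (paraHopf k G).antipode) (fun r x m => by
        change ((paraHopf k G).diagAct n).map ((paraHopf k G).antipode ((paraHopf k G).tgt r * x)) m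
          = ((paraHopf k G).diagAct n).map ((paraHopf k G).antipode x)
            (((paraHopf k G).pow n).act r m)
        rw [(paraHopf k G).antipode_tgt_mul]
        exact ((paraHopf k G).diagAct n).map_right r _ m)

/-- The first factor, inverted, acts diagonally on the others and moves the base point from `x₀` to
`x₁`, as in `τ` but with nothing appended. -/
theorem del_elt {X : G} (n : ℕ) (x : ℕ → Into X) :
    del k G n (elt k (n + 1) x) = elt k n fun m => x (m + 1) := by
  cases n with
  | zero => exact (congrArg counitMap (invMap_of ((x 0).div (x 1)).mor)).trans (counitMap_of _)
  | succ n =>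
    change ((paraHopf k G).diagAct n).map ((paraHopf k G).antipode (of ((x 0).div (x 1)).mor))
      (pure k n fun m => (x 0).div (x (m + 1 + 1))) = _
    rw [antipode_mor, diagAct_pure]
    exact pure_congr _ fun m _ => Into.push_div _ _ _

theorem del_comp_cof_zero (n : ℕ) :
    del k G n ∘ₗ (paraHopf k G).natural.cof n 0 = LinearMap.id := natural_hom_ext n fun X x => by
  rw [LinearMap.comp_apply, cof_elt _ _ (by omega), del_elt]
  exact elt_congr _ fun m _ => by simp [cofSeq, dup]

/-- The bound leaves out the last coface: it appends `x₀`, whereas after the deletion it would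
append `x₁`. -/
theorem del_comp_cof_succ (n i : ℕ) (hi : i ≤ n) :
    del k G (n + 1) ∘ₗ (paraHopf k G).natural.cof (n + 1) (i + 1)
      = (paraHopf k G).natural.cof n i ∘ₗ del k G n := natural_hom_ext (n + 1) fun X x => by
  rw [LinearMap.comp_apply, LinearMap.comp_apply, cof_elt _ _ (by omega), del_elt, del_elt,
    cof_elt _ _ (by omega)]
  refine elt_congr _ fun m _ => ?_
  simp only [cofSeq_apply]
  split_ifs <;> first | rfl | omega | (congr 1; omega)

/-! ### The contraction of the `b` columns. -/

open Classical in
/-- The linear map with `g ↦ g` if `g` is an identity and `g ↦ 0` otherwise. -/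
def unitPart : GroupoidAlgebra k G →ₗ[k] Base k G :=
  extend fun g => if g = Mor.one g.tgt then of (unitOne g.tgt) else 0

theorem unitPart_one (X : G) : unitPart (of (Mor.one X)) = (of (unitOne X) : Base k G) :=
  (extend_of _ _).trans (if_pos rfl)

theorem unitPart_ne (g : Mor G) (hg : g ≠ Mor.one g.tgt) : unitPart (of g) = (0 : Base k G) :=
  (extend_of _ _).trans (if_neg hg)

/-- On identities this is multiplication in `R`, and left multiplication by `R` never turns a
non-identity into an identity. With `r` on the right, it is the balancing condition needed for
`delEq`. -/
theorem unitPart_incl_mul (r : Base k G) (x : GroupoidAlgebra k G) :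
    unitPart (incl r * x) = unitPart x * r := by
  induction r using ind_base with
  | h0 => simp
  | hadd a b ha hb => simp [add_mul, mul_add, ha, hb]
  | hsmul c a ha => simp [ha]
  | hof X =>
    induction x using ind with
    | h0 => simp
    | hadd a b ha hb => simp [mul_add, add_mul, ha, hb]
    | hsmul c a ha => simp [ha]
    | hof g =>
      rw [incl_of]
      by_cases hg : g = Mor.one g.tgt
      · generalize g.tgt = Y at hg
        subst hg
        by_cases h : X = Y
        · subst h
          rw [unitPart_one, unitOne_mul, ← unitPart_one]
          exact congrArg unitPart (one_mul_of (Mor.one X))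
        · rw [unitPart_one, unitOne_mul_ne _ _ (fun e => h e.symm),
            one_mul_of_ne X (Mor.one Y) h, map_zero]
      · rw [unitPart_ne g hg, zero_mul]
        by_cases h : X = g.tgt
        · subst h; rw [one_mul_of, unitPart_ne g hg]
        · rw [one_mul_of_ne X g h, map_zero]

variable (k G) in
/-- The contraction deleting `x₀` if `x₀ = x₁`, and `0` otherwise. -/
def delEq : (n : ℕ) → (paraHopf k G).natural.X (n + 1) →ₗ[k] (paraHopf k G).natural.X n
  | 0 => unitPart
  | n + 1 => (paraHopf k G).lift (M := (paraHopf k G).pow n)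
      (((paraHopf k G).pow n).act.toLinearMap.comp unitPart) (fun r x m => by
        change ((paraHopf k G).pow n).act (unitPart (incl r * x)) m
          = ((paraHopf k G).pow n).act (unitPart x) (((paraHopf k G).pow n).act r m)
        rw [unitPart_incl_mul, map_mul]
        rfl)

theorem unitPart_div_self {X : G} (a : Into X) :
    unitPart (of (a.div a).mor) = (of (unitOne a.1) : Base k G) := by
  rw [Into.div_self]
  exact unitPart_one a.1

/-- If `a⁻¹b` were an identity, it would equal `a⁻¹a`, and cancellation would give `a = b`. -/
theorem unitPart_div {X : G} (a b : Into X) (h : a ≠ b) :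
    unitPart (of (a.div b).mor) = (0 : Base k G) := by
  refine unitPart_ne _ fun e => h ?_
  have e' : (a.div b).mor = (a.div a).mor := e.trans (by rw [Into.div_self]; rfl)
  exact (a.div_injective (Into.mor_injective e')).symm

theorem delEq_elt {X : G} (n : ℕ) (x : ℕ → Into X) (h : x 0 = x 1) :
    delEq k G n (elt k (n + 1) x) = elt k n fun m => x (m + 1) := by
  have hx : elt k (n + 1) x = elt k (n + 1) (cons (x 1) fun m => x (m + 1)) :=
    elt_congr _ fun m _ => by cases m <;> simp [cons, h]
  rw [hx]
  cases n with
  | zero => exact unitPart_div_self (x 1)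
  | succ n =>
    change ((paraHopf k G).pow n).act (unitPart (of ((x 1).div (x 1)).mor))
      (pure k n fun m => (x 1).div (x (m + 1 + 1))) = _
    rw [unitPart_div_self, act_pure]
    rfl

theorem delEq_elt_ne {X : G} (n : ℕ) (x : ℕ → Into X) (h : x 0 ≠ x 1) :
    delEq k G n (elt k (n + 1) x) = 0 := by
  cases n with
  | zero => exact unitPart_div _ _ h
  | succ n =>
    change ((paraHopf k G).pow n).act (unitPart (of ((x 0).div (x 1)).mor))
      (pure k n fun m => (x 0).div (x (m + 1 + 1))) = 0
    rw [unitPart_div _ _ h, map_zero]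
    rfl

theorem delEq_comp_cof_zero (n : ℕ) :
    delEq k G n ∘ₗ (paraHopf k G).natural.cof n 0 = LinearMap.id := natural_hom_ext n fun X x => by
  rw [LinearMap.comp_apply, cof_elt _ _ (by omega), delEq_elt _ _ (by simp [cofSeq, dup])]
  exact elt_congr _ fun m _ => by simp [cofSeq, dup]

/-- These cofaces leave `x₀` and `x₁` in place, so the test `x₀ = x₁` is unaffected. When it
succeeds, appending `x₀` and appending `x₁` agree, which is why the last coface is now included. -/
theorem delEq_comp_cof_succ (n i : ℕ) (hi : i ≤ n + 1) :
    delEq k G (n + 1) ∘ₗ (paraHopf k G).natural.cof (n + 1) (i + 1)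
      = (paraHopf k G).natural.cof n i ∘ₗ delEq k G n := natural_hom_ext (n + 1) fun X x => by
  have h₀ : cofSeq (n + 1) (i + 1) x 0 = x 0 := by
    simp only [cofSeq]; split_ifs <;> simp [dup, snoc]
  have h₁ : cofSeq (n + 1) (i + 1) x 1 = x 1 := by
    simp only [cofSeq]; split_ifs <;> simp [dup, snoc]
  rw [LinearMap.comp_apply, LinearMap.comp_apply, cof_elt _ _ (by omega)]
  by_cases h : x 0 = x 1
  · rw [delEq_elt _ _ (by rw [h₀, h₁, h]), delEq_elt _ _ h, cof_elt _ _ hi]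
    refine elt_congr _ fun m _ => ?_
    simp only [cofSeq_apply]
    -- The equality `x 0 = x 1` settles the entry appended by the last coface.
    split_ifs <;> first | rfl | omega | exact h | (congr 1; omega)
  · rw [delEq_elt_ne _ _ (by rwa [h₀, h₁]), delEq_elt_ne _ _ h, map_zero]

/-! ### Exactness of the columns for a groupoid algebra, and the conclusion. -/

theorem natural_exactColumns : (paraHopf k G).natural.ExactColumns where
  exact_b n x hx := by
    have := CocyclicData.contraction_comp_b _ _ (delEq_comp_cof_zero (n + 1))
      (delEq_comp_cof_succ n) x
    rw [hx, map_zero] at this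
    exact ⟨_, (sub_eq_zero.1 this.symm).symm⟩
  exact_b' n x hx := by
    have := CocyclicData.contraction_comp_b' _ _ (del_comp_cof_zero (n + 1))
      (del_comp_cof_succ n) x
    rw [hx, map_zero] at this
    exact ⟨_, (sub_eq_zero.1 this.symm).symm⟩
  b_zero := by
    -- With a single coordinate, doubling `x₀` and appending `x₀` are the same operation.
    have : (paraHopf k G).natural.cof 0 1 = (paraHopf k G).natural.cof 0 0 :=
      natural_hom_ext 0 fun X x => by
        rw [cof_elt _ _ (by omega), cof_elt _ _ (by omega)]
        refine elt_congr 1 fun m hm => ?_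
        obtain rfl | rfl : m = 0 ∨ m = 1 := by omega
        all_goals simp [cofSeq, dup, snoc]
    rw [CocyclicData.b_eq_sum, Finset.sum_range_succ, Finset.sum_range_one, this]
    simp
  b'_zero x hx := by
    rw [CocyclicData.b'_eq_sum, Finset.sum_range_one, pow_zero, one_smul] at hx
    -- In degree `0`, `b'` is `δ₀` alone, and `del` is a left inverse of it.
    have := LinearMap.congr_fun (del_comp_cof_zero (k := k) (G := G) 0) x
    rw [LinearMap.comp_apply, hx, map_zero] at this
    exact this.symm

end GroupoidAlgebra

end

theorem mainTheorem5 {k : Type w} [Field k] [CharZero k] {G : Type u} [Groupoid.{v} G]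
    [Fintype G] :
    (∀ n : ℕ, (GroupoidAlgebra.paraHopf k G).natural.d (n + 1) ∘ₗ
      (GroupoidAlgebra.paraHopf k G).natural.d n = 0) ∧
    (∀ i : ℕ, Subsingleton ((GroupoidAlgebra.paraHopf k G).HC (2 * i + 1))) ∧
    ∀ i : ℕ,
      Nonempty ((GroupoidAlgebra.paraHopf k G).HC (2 * i) ≃ₗ[k] GroupoidAlgebra.Base k G) :=
  ⟨GroupoidAlgebra.natural_identities.d_comp_d,
    fun i => GroupoidAlgebra.natural_exactColumns.subsingleton_HC
      GroupoidAlgebra.natural_identities (by simp),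
    fun i => GroupoidAlgebra.natural_exactColumns.nonempty_HC_equiv
      GroupoidAlgebra.natural_identities rfl (by simp)⟩
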